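/- Let $M$ be a smooth manifold of dimension $n$, let $A^k(M)=\Gamma(\wedge^kTM)$ (with $A^{-1}(M)=0$), and let $\mathcal A(M)=\bigoplus_{k\ge 0}A^k(M)$ be the algebra of multivector fields, with $A^0(M)=C^\infty(M)$. For $X\in A^k(M)$ and $f\in C^\infty(M)$, let $[X,f]\in A^{k-1}(M)$ be the Schouten–Nijenhuis bracket; thus $[X_1\wedge\cdots\wedge X_k,f]=\sum_j(-1)^{k-j}X_j(f)\,X_1\wedge\cdots\widehat{X_j}\cdots\wedge X_k$. A higher connection on $M$ is a map $\nabla:\mathcal A(M)\times\mathcal A(M)\to\mathcal A(M)$, $(X,Y)\mapsto\nabla_XY$, such that (i) $\nabla_XY\in A^{k+l-1}(M)$ for $X\in A^k(M)$, $Y\in A^l(M)$; (ii) $\nabla_{fX+X'}Y=f\nabla_XY+\nabla_{X'}Y$; (iii) $\nabla_X(Y+Y')=\nabla_XY+\nabla_XY'$; (iv) $\nabla_Xf=[X,f]$ for $X\in A^k(M)$, $f\in C^\infty(M)$; (v) $\nabla_X(fY)=[X,f]\wedge Y+f\nabla_XY$ for $X\in A^k(M)$, $f\in C^\infty(M)$;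 (vi) $\nabla_fX=0$ for $f\in C^\infty(M)$. It is called induced if $$\nabla_{X\wedge Y}Z=X\wedge\nabla_YZ+(-1)^{kl}\,Y\wedge\nabla_XZ,\qquad \nabla_X(Y\wedge Z)=(\nabla_XY)\wedge Z+(-1)^{(k-1)l}\,Y\wedge\nabla_XZ$$ for all $k,l\ge 0$, $X\in A^k(M)$, $Y\in A^l(M)$, $Z\in\mathcal A(M)$. An induced higher connection is said to be induced by an affine connection $\widetilde\nabla$ on $TM$ if it restricts to $\widetilde\nabla$ on vector fields; it is then also denoted $\widetilde\nabla$. Theorem. Let $\nabla$ be a higher connection on $M$. There is a unique pair $(\widetilde\nabla,\{F^{k,l}\})$, consisting of an affine connection $\widetilde\nabla$ on $TM$ and smooth sections $F^{k,l}$ of $\wedge^{k+l-1}TM\otimes\wedge^kT^*M\otimes\wedge^lT^*M$ for $k,l>0$ with $k+l-1\le n$, $F^{1,1}\equiv0$, such that $$\nabla_XY=\widetilde\nabla_XY+F^{k,l}(X,Y)$$ for all such $k,l$ and all $X\in A^k(M)$, $Y\in A^l(M)$, where $\widetilde\nabla_XY$ is taken with respect to a higher connection induced by the affine connection $\widetilde\nabla$.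 For this pair, $\nabla$ is induced if and only if $F^{k,l}\equiv 0$ for all $k,l$ (that is, all twist fields vanish). -/

import Mathlib

open scoped Manifold ContDiff

noncomputable section

namespace HigherConn

/-- The model space `ℝⁿ`. -/
abbrev Model (n : ℕ) : Type := EuclideanSpace ℝ (Fin n)

section Fields

variable (n : ℕ) (M : Type*) [TopologicalSpace M] [ChartedSpace (Model n) M]

/-- The ring `C^∞(M)`. -/
abbrev SmoothFun : Type _ := C^∞⟮𝓡 n, M; ℝ⟯

/-- All (not necessarily smooth) sections of the bundle `⋀^• TM`, with the pointwise operations;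
the product is the wedge product. -/
abbrev RawField : Type _ := Π x : M, ExteriorAlgebra ℝ (TangentSpace (𝓡 n) x)

variable {n M}

/-- The multivector `X x`, for `x` near `x₀`, read in the exterior algebra of `ℝⁿ` through the
trivialization of `TM` around `x₀`. -/
def coord [IsManifold (𝓡 n) ∞ M] (X : RawField n M) (x₀ x : M) : ExteriorAlgebra ℝ (Model n) :=
  ExteriorAlgebra.map
    ((trivializationAt (Model n) (TangentSpace (𝓡 n) : M → Type _) x₀).continuousLinearMapAt
      ℝ x).toLinearMap (X x)

/-- A section of `⋀^• TM` is smooth if, around each point and in the trivialization there, its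
components (that is, the values of all linear functionals of the finite-dimensional space
`⋀^• ℝⁿ`) are smooth functions. -/
def IsSmooth [IsManifold (𝓡 n) ∞ M] (X : RawField n M) : Prop :=
  ∀ (x₀ : M) (φ : Module.Dual ℝ (ExteriorAlgebra ℝ (Model n))),
    ContMDiffAt (𝓡 n) 𝓘(ℝ, ℝ) ∞ (fun x => φ (coord X x₀ x)) x₀

theorem isSmooth_mul [IsManifold (𝓡 n) ∞ M] {X Y : RawField n M}
    (hX : IsSmooth X) (hY : IsSmooth Y) : IsSmooth (X * Y) := by
  intro x₀ φ
  let b := ((EuclideanSpace.basisFun (Fin n) ℝ).toBasis).ExteriorAlgebra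
  have key : (fun x => φ (coord (X * Y) x₀ x)) = fun x => ∑ s, ∑ t,
      (b.coord s (coord X x₀ x) * b.coord t (coord Y x₀ x)) * φ (b s * b t) := by
    funext x
    have h : coord (X * Y) x₀ x = coord X x₀ x * coord Y x₀ x := by simp [coord]
    rw [h]
    conv_lhs => rw [← b.sum_repr (coord X x₀ x), ← b.sum_repr (coord Y x₀ x)]
    simp only [Finset.sum_mul_sum, map_sum, smul_mul_smul_comm, map_smul, smul_eq_mul,
      Module.Basis.coord_apply]
  rw [key]
  refine ContMDiffAt.sum fun s _ => ContMDiffAt.sum fun t _ => ?_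
  exact ((hX x₀ _).mul (hY x₀ _)).mul contMDiffAt_const

theorem isSmooth_add [IsManifold (𝓡 n) ∞ M] {X Y : RawField n M}
    (hX : IsSmooth X) (hY : IsSmooth Y) : IsSmooth (X + Y) := by
  intro x₀ φ
  have h : (fun x => φ (coord (X + Y) x₀ x)) =
      fun x => φ (coord X x₀ x) + φ (coord Y x₀ x) := by
    funext x; simp [coord]
  rw [h]
  exact (hX x₀ φ).add (hY x₀ φ)

/-- A function, seen as a field of multivectors of degree `0`. -/
def rawOfFun (f : M → ℝ) : RawField n M := fun x => algebraMap ℝ _ (f x)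

theorem isSmooth_rawOfFun [IsManifold (𝓡 n) ∞ M] {f : M → ℝ}
    (hf : ContMDiff (𝓡 n) 𝓘(ℝ, ℝ) ∞ f) : IsSmooth (rawOfFun (n := n) f) := by
  intro x₀ φ
  have h : (fun x => φ (coord (rawOfFun f) x₀ x)) = fun x => f x * φ 1 := by
    funext x
    simp [coord, rawOfFun, Algebra.algebraMap_eq_smul_one]
  rw [h]
  exact (hf x₀).mul contMDiffAt_const

variable (n M)

/-- The algebra `𝒜(M) = ⨁ₖ Aᵏ(M)` of multivector fields: the smooth sections of `⋀^• TM`, with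
the wedge product as multiplication. -/
def MVF [IsManifold (𝓡 n) ∞ M] : Subring (RawField n M) where
  carrier := {X | IsSmooth X}
  mul_mem' := isSmooth_mul
  add_mem' := isSmooth_add
  one_mem' := by
    have h : (1 : RawField n M) = rawOfFun (fun _ => (1 : ℝ)) := by
      funext x; simp [rawOfFun]
    rw [h]; exact isSmooth_rawOfFun contMDiff_const
  zero_mem' := by
    have h : (0 : RawField n M) = rawOfFun (fun _ => (0 : ℝ)) := by
      funext x; simp [rawOfFun]
    rw [h]; exact isSmooth_rawOfFun contMDiff_const
  neg_mem' := by
    intro X hX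
    have h : -X = rawOfFun (fun _ => (-1 : ℝ)) * X := by
      funext x; simp [rawOfFun]
    rw [h]; exact isSmooth_mul (isSmooth_rawOfFun contMDiff_const) hX

/-- The inclusion of `C^∞(M) = A⁰(M)` in `𝒜(M)`. -/
def ofFun [IsManifold (𝓡 n) ∞ M] : SmoothFun n M →+* MVF n M where
  toFun f := ⟨rawOfFun f, isSmooth_rawOfFun f.contMDiff⟩
  map_one' := by ext x; simp [rawOfFun]
  map_mul' f g := by ext x; simp [rawOfFun]
  map_zero' := by ext x; simp [rawOfFun]
  map_add' f g := by ext x; simp [rawOfFun]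

/-- `𝒜(M)` is an algebra over `C^∞(M)`, by pointwise multiplication. -/
instance [IsManifold (𝓡 n) ∞ M] : Algebra (SmoothFun n M) (MVF n M) :=
  (ofFun n M).toAlgebra' fun f X => by
    ext x; exact Algebra.commutes (f x) (X.1 x)

/-- The space `Aᵏ(M)` of `k`-vector fields. -/
def A [IsManifold (𝓡 n) ∞ M] (k : ℕ) : Submodule (SmoothFun n M) (MVF n M) where
  carrier := {X | ∀ x, X.1 x ∈ ⋀[ℝ]^k (TangentSpace (𝓡 n) x)}
  add_mem' hX hY x := Submodule.add_mem _ (hX x) (hY x)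
  zero_mem' x := Submodule.zero_mem _
  smul_mem' f X hX x := by
    have h : (f • X).1 x = f x • X.1 x := by
      rw [Algebra.smul_def, Algebra.smul_def]; rfl
    rw [h]
    exact Submodule.smul_mem _ _ (hX x)

/-- Smooth vector fields: smooth sections of `TM`. -/
abbrev VField [IsManifold (𝓡 n) ∞ M] : Type _ :=
  Cₛ^∞⟮𝓡 n; Model n, (TangentSpace (𝓡 n) : M → Type _)⟯

variable {n M}

/-- The product of a smooth function and a smooth vector field. -/
def fsmul [IsManifold (𝓡 n) ∞ M] (f : SmoothFun n M) (V : VField n M) : VField n M :=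
  ⟨fun x => f x • V x, f.contMDiff.smul_section V.contMDiff⟩

/-- A vector field as an element of `A¹(M)`. -/
def ofVField [IsManifold (𝓡 n) ∞ M] (V : VField n M) : MVF n M :=
  ⟨fun x => ExteriorAlgebra.ι ℝ (V x), by
    intro x₀ φ
    let e := trivializationAt (Model n) (TangentSpace (𝓡 n) : M → Type _) x₀
    have hV := (Bundle.contMDiffAt_section (IB := 𝓡 n) (n := ∞) x₀).1 (V.contMDiff x₀)
    let ψ : Model n →L[ℝ] ℝ := LinearMap.toContinuousLinearMap (φ ∘ₗ ExteriorAlgebra.ι ℝ)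
    have h2 : ContMDiffAt (𝓡 n) 𝓘(ℝ, ℝ) ∞ (fun x => ψ (e ⟨x, V x⟩).2) x₀ :=
      ψ.contMDiff.contMDiffAt.comp x₀ hV
    refine h2.congr_of_eventuallyEq ?_
    have hb : e.baseSet ∈ nhds x₀ :=
      e.open_baseSet.mem_nhds (FiberBundle.mem_baseSet_trivializationAt' x₀)
    filter_upwards [hb] with x hx
    simp only [coord, ψ, ExteriorAlgebra.map_apply_ι, LinearMap.coe_toContinuousLinearMap',
      LinearMap.comp_apply, ContinuousLinearMap.coe_coe]
    exact congrArg (fun v => φ (ExteriorAlgebra.ι ℝ v))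
      (Bundle.Trivialization.continuousLinearMapAt_apply_of_mem (R := ℝ) e hx (V x))⟩

/-- The Schouten–Nijenhuis bracket `[X, f]` of a multivector field and a function: for
`X = X₁ ∧ ⋯ ∧ Xₖ` it is `∑ⱼ (-1)^(k-j) Xⱼ(f) X₁ ∧ ⋯ X̂ⱼ ⋯ ∧ Xₖ`, that is, `(-1)^(k-1) i_{df} X`,
which is the contraction of `X` with `df` from the right. -/
def bracket [IsManifold (𝓡 n) ∞ M] (X : MVF n M) (f : SmoothFun n M) : RawField n M :=
  fun x => CliffordAlgebra.contractRight (X.1 x) (mvfderiv (𝓡 n) f x).toLinearMap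

/-- `[g, f] = 0` for functions `f`, `g`. -/
theorem bracket_ofFun [IsManifold (𝓡 n) ∞ M] (g f : SmoothFun n M) :
    bracket (ofFun n M g) f = 0 := by
  funext x
  exact CliffordAlgebra.contractRight_algebraMap _ _ _

/-- `[V, f] = V(f)` for a vector field `V`. -/
theorem bracket_ofVField [IsManifold (𝓡 n) ∞ M] (V : VField n M) (f : SmoothFun n M) :
    bracket (ofVField V) f = rawOfFun fun x => mvfderiv (𝓡 n) f x (V x) := by
  funext x
  exact CliffordAlgebra.contractRight_ι _ _ _

/-- `[X ∧ V, f] = V(f) X - [X, f] ∧ V` for a vector field `V`. -/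
theorem bracket_mul_ofVField [IsManifold (𝓡 n) ∞ M] (X : MVF n M) (V : VField n M)
    (f : SmoothFun n M) (x : M) :
    bracket (X * ofVField V) f x =
      mvfderiv (𝓡 n) f x (V x) • X.1 x - bracket X f x * (ofVField V).1 x :=
  CliffordAlgebra.contractRight_mul_ι _ _ _

end Fields

section Connections

variable (n : ℕ) (M : Type*) [TopologicalSpace M] [ChartedSpace (Model n) M]
  [IsManifold (𝓡 n) ∞ M]

/-- An affine connection on `TM`. -/
@[ext]
structure AffineConnection where
  /-- `toFun V W` is the covariant derivative of `W` along `V`. -/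
  toFun : VField n M → VField n M → VField n M
  add_left : ∀ V V' W, toFun (V + V') W = toFun V W + toFun V' W
  smul_left : ∀ f V W, toFun (fsmul f V) W = fsmul f (toFun V W)
  add_right : ∀ V W W', toFun V (W + W') = toFun V W + toFun V W'
  const_smul_right : ∀ (c : ℝ) V W, toFun V (c • W) = c • toFun V W
  leibniz : ∀ (f : SmoothFun n M) V W (x : M),
    toFun V (fsmul f W) x = mvfderiv (𝓡 n) f x (V x) • W x + f x • toFun V W x

/-- A higher affine connection on `M`. -/
@[ext]
structure HigherConnection where
  /-- `toFun X Y` is `∇_X Y`. -/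
  toFun : MVF n M → MVF n M → MVF n M
  /-- `∇_X Y ∈ A^(k+l-1)(M)`. For `k = l = 0`, where `A^(-1)(M) = 0`, see `fun_left`. -/
  degree : ∀ k l m : ℕ, m + 1 = k + l → ∀ X ∈ A n M k, ∀ Y ∈ A n M l, toFun X Y ∈ A n M m
  linear_left : ∀ (f : SmoothFun n M) X X' Y, toFun (f • X + X') Y = f • toFun X Y + toFun X' Y
  add_right : ∀ X Y Y', toFun X (Y + Y') = toFun X Y + toFun X Y'
  apply_fun : ∀ k, ∀ X ∈ A n M k, ∀ f : SmoothFun n M,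
    (toFun X (ofFun n M f)).1 = bracket X f
  leibniz : ∀ k, ∀ X ∈ A n M k, ∀ (f : SmoothFun n M) (Y : MVF n M),
    (toFun X (f • Y)).1 = bracket X f * Y.1 + (f • toFun X Y).1
  fun_left : ∀ (f : SmoothFun n M) X, toFun (ofFun n M f) X = 0

variable {n M}

/-- A higher connection is induced if it satisfies, for `X ∈ Aᵏ(M)`, `Y ∈ Aˡ(M)` and `Z ∈ 𝒜(M)`,
`∇_{X ∧ Y} Z = X ∧ ∇_Y Z + (-1)^(kl) Y ∧ ∇_X Z` and
`∇_X (Y ∧ Z) = ∇_X Y ∧ Z + (-1)^((k-1)l) Y ∧ ∇_X Z`.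
The second sign is written `(-1)^((k+1)l)`, which is the same and also correct for `k = 0`. -/
def HigherConnection.IsInduced (D : HigherConnection n M) : Prop :=
  ∀ k l : ℕ, ∀ X ∈ A n M k, ∀ Y ∈ A n M l, ∀ Z : MVF n M,
    D.toFun (X * Y) Z = X * D.toFun Y Z + (-1) ^ (k * l) * (Y * D.toFun X Z) ∧
    D.toFun X (Y * Z) = D.toFun X Y * Z + (-1) ^ ((k + 1) * l) * (Y * D.toFun X Z)

/-- The higher connection `D` is the one induced by the affine connection `c`: it is induced and
its restriction to vector fields is `c`. -/
def IsInducedBy (D : HigherConnection n M) (c : AffineConnection n M) : Prop :=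
  D.IsInduced ∧ ∀ V W : VField n M, D.toFun (ofVField V) (ofVField W) = ofVField (c.toFun V W)

variable (n M)

/-- A smooth section of `⋀ᵐ TM ⊗ ⋀ᵏ T*M ⊗ ⋀ˡ T*M`, seen as a family of bilinear maps
`⋀ᵏ TₓM × ⋀ˡ TₓM → ⋀ᵐ TₓM` that sends smooth sections to smooth sections. -/
@[ext]
structure TensorField (k l m : ℕ) where
  /-- The bilinear map at a point. -/
  toFun : ∀ x : M, ⋀[ℝ]^k (TangentSpace (𝓡 n) x) →ₗ[ℝ] ⋀[ℝ]^l (TangentSpace (𝓡 n) x) →ₗ[ℝ]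
    ⋀[ℝ]^m (TangentSpace (𝓡 n) x)
  smooth : ∀ (X : A n M k) (Y : A n M l),
    IsSmooth fun x => (toFun x ⟨X.1.1 x, X.2 x⟩ ⟨Y.1.1 x, Y.2 x⟩ :
      ExteriorAlgebra ℝ (TangentSpace (𝓡 n) x))

/-- A pair formed by an affine connection on `TM` and a collection of sections `F^{k,l}` of
`⋀^(k+l-1) TM ⊗ ⋀ᵏ T*M ⊗ ⋀ˡ T*M`, for `k, l > 0` with `k + l - 1 ≤ dim M`, such that
`F^{1,1} = 0`. -/
@[ext]
structure ConnectionData where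
  /-- The affine connection. -/
  conn : AffineConnection n M
  /-- The tensor fields `F^{k,l}`. -/
  twist : ∀ k l : ℕ, 0 < k → 0 < l → k + l - 1 ≤ n → TensorField n M k l (k + l - 1)
  twist_one_one : ∀ (h : 1 + 1 - 1 ≤ n) (x : M),
    (twist 1 1 one_pos one_pos h).toFun x = 0

variable {n M}

/-- The pair `d = (c, F)` is associated to the higher connection `N`: if `D` is the higher
connection induced by `c`, then `N_X Y = D_X Y + F^{k,l}(X, Y)` for `X ∈ Aᵏ(M)`, `Y ∈ Aˡ(M)`. -/
def IsAssociated (N : HigherConnection n M) (d : ConnectionData n M) : Prop :=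
  ∃ D : HigherConnection n M, IsInducedBy D d.conn ∧
    ∀ (k l : ℕ) (hk : 0 < k) (hl : 0 < l) (hkl : k + l - 1 ≤ n)
      (X : A n M k) (Y : A n M l) (x : M),
      (N.toFun X Y).1 x = (D.toFun X Y).1 x +
        ((d.twist k l hk hl hkl).toFun x ⟨X.1.1 x, X.2 x⟩ ⟨Y.1.1 x, Y.2 x⟩ :
          ExteriorAlgebra ℝ (TangentSpace (𝓡 n) x))

end Connections

end HigherConn

end

/-!
Every multivector field is locally a combination, with smooth coefficients, of wedge products of
vector fields, so the two Leibniz rules leave at most one induced higher connection extending a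
given affine connection. It exists: extend the affine connection to a derivation `Y ↦ ∇Y` of the
algebra of multivector fields, a sum of the flat derivative in a trivialization and of the
Christoffel symbols, and substitute `∇Y` in the last slot of `X`.

The first-order terms `[X, f] ∧ Y` of the Leibniz rule are the same for all higher connections.
Hence the difference of two of them is `C^∞(M)`-bilinear, that is, a family of tensor fields. The
twist fields of `∇` are the components of its difference with the higher connection induced by
its restriction to vector fields, and `∇` is induced exactly when this difference vanishes.
-/

noncomputable section

namespace HigherConn

open CliffordAlgebra (contractRight involute)
open scoped Topology

section ExteriorAlgebra

variable {R V : Type*} [CommRing R] [AddCommGroup V] [Module R V]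

local notation "Λ" => ExteriorAlgebra R V

theorem ι_mem_exteriorPower_one (v : V) : ExteriorAlgebra.ι R v ∈ ⋀[R]^1 V := by
  rw [ExteriorAlgebra.exteriorPower, pow_one]
  exact LinearMap.mem_range_self _ v

theorem mem_exteriorPower_zero {a : Λ} : a ∈ ⋀[R]^0 V ↔ ∃ r : R, algebraMap R _ r = a := by
  rw [ExteriorAlgebra.exteriorPower, pow_zero, Submodule.mem_one]

theorem mul_mem_exteriorPower {k l : ℕ} {a b : Λ} (ha : a ∈ ⋀[R]^k V) (hb : b ∈ ⋀[R]^l V) :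
    a * b ∈ ⋀[R]^(k + l) V :=
  SetLike.GradedMul.mul_mem ha hb

@[elab_as_elim]
theorem exteriorPower_succ_induction {k : ℕ} {a : Λ} (ha : a ∈ ⋀[R]^(k + 1) V)
    {C : Λ → Prop} (mul : ∀ a ∈ ⋀[R]^k V, ∀ v, C (a * ExteriorAlgebra.ι R v))
    (add : ∀ a b, C a → C b → C (a + b)) : C a := by
  rw [ExteriorAlgebra.exteriorPower, pow_succ] at ha
  refine Submodule.mul_induction_on ha ?_ add
  rintro a ha _ ⟨v, rfl⟩
  exact mul a ha v

theorem exteriorPower_eq_bot_of_finrank_lt [Nontrivial R] [Module.Free R V] [Module.Finite R V]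
    {k : ℕ} (h : Module.finrank R V < k) : ⋀[R]^k V = ⊥ := by
  rw [← Submodule.subsingleton_iff_eq_bot, ← Module.finrank_eq_zero_iff_of_free R,
    exteriorPower.finrank_eq, Nat.choose_eq_zero_of_lt h]

instance finite_exteriorAlgebra [Nontrivial R] [Module.Free R V] [Module.Finite R V] :
    Module.Finite R Λ :=
  haveI : Finite (Finset (Fin (Module.finrank R V))) := inferInstance
  .of_basis (Module.finBasis R V).ExteriorAlgebra

theorem map_mem_exteriorPower {W : Type*} [AddCommGroup W] [Module R W] (f : V →ₗ[R] W) {k : ℕ}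
    {a : Λ} (ha : a ∈ ⋀[R]^k V) : ExteriorAlgebra.map f a ∈ ⋀[R]^k W := by
  have hι : (LinearMap.range (ExteriorAlgebra.ι R (M := V))).map
      (ExteriorAlgebra.map f).toLinearMap ≤ LinearMap.range (ExteriorAlgebra.ι R) := by
    rintro _ ⟨_, ⟨v, rfl⟩, rfl⟩
    exact ⟨f v, (ExteriorAlgebra.map_apply_ι f v).symm⟩
  have hpow := pow_le_pow_left' hι k
  rw [← Submodule.map_pow] at hpow
  exact hpow (Submodule.mem_map_of_mem ha)

theorem involute_of_mem {k : ℕ} {a : Λ} (ha : a ∈ ⋀[R]^k V) : involute a = (-1) ^ k * a := by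
  induction k generalizing a with
  | zero =>
    obtain ⟨r, rfl⟩ := mem_exteriorPower_zero.1 ha
    rw [AlgHom.commutes, pow_zero, one_mul]
  | succ k ih =>
    refine exteriorPower_succ_induction ha (fun a ha v => ?_) fun a b ha hb => ?_
    · rw [map_mul, ih ha, CliffordAlgebra.involute_ι, pow_succ]
      noncomm_ring
    · rw [map_add, ha, hb, mul_add]

theorem ι_mul_eq_involute_mul_ι (v : V) (a : Λ) :
    ExteriorAlgebra.ι R v * a = involute a * ExteriorAlgebra.ι R v := by
  induction a using ExteriorAlgebra.induction with
  | algebraMap r => rw [AlgHom.commutes, Algebra.commutes]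
  | ι w =>
    rw [CliffordAlgebra.involute_ι, neg_mul]
    exact eq_neg_of_add_eq_zero_left (ExteriorAlgebra.ι_add_mul_swap v w)
  | mul a b ha hb => rw [map_mul, ← mul_assoc, ha, mul_assoc, hb, mul_assoc]
  | add a b ha hb => rw [map_add, mul_add, add_mul, ha, hb]

theorem mul_comm_of_mem_exteriorPower {k l : ℕ} {a b : Λ} (ha : a ∈ ⋀[R]^k V)
    (hb : b ∈ ⋀[R]^l V) : a * b = (-1) ^ (k * l) * (b * a) := by
  induction k generalizing a with
  | zero =>
    obtain ⟨r, rfl⟩ := mem_exteriorPower_zero.1 ha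
    rw [Nat.zero_mul, pow_zero, one_mul, Algebra.commutes]
  | succ k ih =>
    refine exteriorPower_succ_induction ha (fun a ha v => ?_) fun a a' h h' => ?_
    · have hcomm : Commute a ((-1) ^ l) := (Commute.neg_one_right a).pow_right l
      rw [mul_assoc, ι_mul_eq_involute_mul_ι, involute_of_mem hb, mul_assoc, hcomm.left_comm,
        ← mul_assoc a, ih ha, add_one_mul, add_comm, pow_add]
      simp only [mul_assoc]
    · rw [add_mul, h, h', mul_add, mul_add]

theorem contractRight_mul (a b : Λ) (d : Module.Dual R V) :
    contractRight (a * b) d = a * contractRight b d + contractRight a d * involute b := by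
  induction b using CliffordAlgebra.right_induction with
  | algebraMap r =>
    rw [CliffordAlgebra.contractRight_mul_algebraMap, CliffordAlgebra.contractRight_algebraMap,
      AlgHom.commutes, mul_zero, zero_add]
  | add b b' h h' => simp only [mul_add, map_add, LinearMap.add_apply, h, h']; abel
  | mul_ι v b h =>
    rw [← mul_assoc, CliffordAlgebra.contractRight_mul_ι, CliffordAlgebra.contractRight_mul_ι, h,
      map_mul, CliffordAlgebra.involute_ι, mul_sub, mul_smul_comm]
    noncomm_ring

theorem contractRight_eq_zero {a : Λ} (ha : a ∈ ⋀[R]^0 V) (d : Module.Dual R V) :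
    contractRight a d = 0 := by
  obtain ⟨r, rfl⟩ := mem_exteriorPower_zero.1 ha
  exact CliffordAlgebra.contractRight_algebraMap _ _ _

theorem contractRight_mem {k : ℕ} {a : Λ} (ha : a ∈ ⋀[R]^(k + 1) V) (d : Module.Dual R V) :
    contractRight a d ∈ ⋀[R]^k V := by
  induction k generalizing a with
  | zero =>
    refine exteriorPower_succ_induction ha (fun a ha v => ?_) fun a b ha hb => ?_
    · rw [ExteriorAlgebra.ι, CliffordAlgebra.contractRight_mul_ι, contractRight_eq_zero ha,
        zero_mul, sub_zero]
      exact Submodule.smul_mem _ _ ha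
    · rw [map_add]; exact Submodule.add_mem _ ha hb
  | succ k ih =>
    refine exteriorPower_succ_induction ha (fun a ha v => ?_) fun a b ha hb => ?_
    · rw [ExteriorAlgebra.ι, CliffordAlgebra.contractRight_mul_ι]
      exact Submodule.sub_mem _ (Submodule.smul_mem _ _ ha)
        (mul_mem_exteriorPower (ih ha) (ι_mem_exteriorPower_one v))
    · rw [map_add]; exact Submodule.add_mem _ ha hb

/- The exponent `(k + 1) * l` stands for `(k - 1) * l`, and is also correct for `k = 0`. -/
theorem contractRight_mul_comm {k l : ℕ} {a b : Λ} (ha : a ∈ ⋀[R]^k V) (hb : b ∈ ⋀[R]^l V)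
    (d : Module.Dual R V) :
    contractRight a d * b = (-1) ^ ((k + 1) * l) * (b * contractRight a d) := by
  cases k with
  | zero => rw [contractRight_eq_zero ha, zero_mul, mul_zero, mul_zero]
  | succ k =>
    have hsign : (k + 1 + 1) * l = k * l + 2 * l := by ring
    rw [mul_comm_of_mem_exteriorPower (contractRight_mem ha d) hb, hsign, pow_add, pow_mul _ 2,
      neg_one_sq, one_pow, mul_one]

theorem contractRight_mul_of_mem {k l : ℕ} {a b : Λ} (ha : a ∈ ⋀[R]^k V) (hb : b ∈ ⋀[R]^l V)
    (d : Module.Dual R V) :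
    contractRight (a * b) d =
      a * contractRight b d + (-1) ^ (k * l) * (b * contractRight a d) := by
  have hsign : (-1 : Λ) ^ l * (-1) ^ ((k + 1) * l) = (-1) ^ (k * l) := by
    rw [← pow_add, show l + (k + 1) * l = k * l + 2 * l by ring, pow_add, pow_mul _ 2,
      neg_one_sq, one_pow, mul_one]
  have hcomm : Commute (contractRight a d) ((-1) ^ l) := (Commute.neg_one_right _).pow_right l
  rw [contractRight_mul, involute_of_mem hb, hcomm.left_comm, contractRight_mul_comm ha hb d,
    ← mul_assoc, hsign]

variable {ι : Type*} [Fintype ι] (b : Module.Basis ι R V)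

/-- The substitution of `T` in the last slot of a multivector: it sends `v₁ ∧ ⋯ ∧ vₖ` to
`∑ⱼ (-1)^(k-j) v₁ ∧ ⋯ v̂ⱼ ⋯ ∧ vₖ ∧ T vⱼ`. This is how an induced higher connection depends on its
first argument, and for `T = ι ∘ L` it is the derivation of the exterior algebra extending `L`.
It does not depend on the basis `b` used to define it. -/
def contract : (V →ₗ[R] Λ) →ₗ[R] Λ →ₗ[R] Λ :=
  LinearMap.mk₂ R (fun T a => ∑ i, contractRight a (b.coord i) * T (b i))
    (fun T T' a => by simp only [LinearMap.add_apply, mul_add, Finset.sum_add_distrib])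
    (fun r T a => by simp only [LinearMap.smul_apply, mul_smul_comm, Finset.smul_sum])
    (fun T a a' => by simp only [map_add, LinearMap.add_apply, add_mul, Finset.sum_add_distrib])
    (fun r T a => by simp only [map_smul, LinearMap.smul_apply, smul_mul_assoc, Finset.smul_sum])

theorem contract_apply (T : V →ₗ[R] Λ) (a : Λ) :
    contract b T a = ∑ i, contractRight a (b.coord i) * T (b i) :=
  rfl

theorem contract_ι (T : V →ₗ[R] Λ) (v : V) : contract b T (ExteriorAlgebra.ι R v) = T v := by
  conv_rhs => rw [← b.sum_repr v]
  simp only [contract_apply, ExteriorAlgebra.ι, CliffordAlgebra.contractRight_ι, map_sum, map_smul,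
    Algebra.smul_def, Module.Basis.coord_apply]

theorem contract_eq_zero (T : V →ₗ[R] Λ) {a : Λ} (ha : a ∈ ⋀[R]^0 V) : contract b T a = 0 :=
  Finset.sum_eq_zero fun i _ => by rw [contractRight_eq_zero ha, zero_mul]

theorem contract_smulRight (d : Module.Dual R V) (y a : Λ) :
    contract b (d.smulRight y) a = contractRight a d * y := by
  have hd : d = ∑ i, d (b i) • b.coord i := (b.sum_dual_apply_smul_coord d).symm
  conv_rhs => rw [hd]
  simp only [contract_apply, LinearMap.smulRight_apply, map_sum, map_smul, Finset.sum_mul,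
    smul_mul_assoc, mul_smul_comm]

theorem contract_mem {k l : ℕ} {T : V →ₗ[R] Λ} (hT : ∀ v, T v ∈ ⋀[R]^l V) {a : Λ}
    (ha : a ∈ ⋀[R]^(k + 1) V) : contract b T a ∈ ⋀[R]^(k + l) V :=
  Submodule.sum_mem _ fun _ _ => mul_mem_exteriorPower (contractRight_mem ha _) (hT _)

theorem contract_mul {k l : ℕ} (T : V →ₗ[R] Λ) {a a' : Λ} (ha : a ∈ ⋀[R]^k V)
    (ha' : a' ∈ ⋀[R]^l V) :
    contract b T (a * a') = a * contract b T a' + (-1) ^ (k * l) * (a' * contract b T a) := by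
  simp only [contract_apply, contractRight_mul_of_mem ha ha', add_mul, Finset.sum_add_distrib,
    Finset.mul_sum, mul_assoc]

theorem contract_of_forall_eq_add {k l : ℕ} {T T₁ T₂ : V →ₗ[R] Λ} {y z : Λ}
    (hT : ∀ v, T v = T₁ v * z + y * T₂ v) {a : Λ} (ha : a ∈ ⋀[R]^k V) (hy : y ∈ ⋀[R]^l V) :
    contract b T a =
      contract b T₁ a * z + (-1) ^ ((k + 1) * l) * (y * contract b T₂ a) := by
  simp only [contract_apply, Finset.sum_mul, Finset.mul_sum, ← Finset.sum_add_distrib]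
  refine Finset.sum_congr rfl fun i _ => ?_
  rw [hT, mul_add, ← mul_assoc, ← mul_assoc, contractRight_mul_comm ha hy]
  simp only [mul_assoc]

theorem contract_ι_comp_mul (L : V →ₗ[R] V) (a a' : Λ) :
    contract b (ExteriorAlgebra.ι R ∘ₗ L) (a * a') =
      contract b (ExteriorAlgebra.ι R ∘ₗ L) a * a' +
        a * contract b (ExteriorAlgebra.ι R ∘ₗ L) a' := by
  simp only [contract_apply, contractRight_mul, LinearMap.comp_apply, add_mul,
    Finset.sum_add_distrib, Finset.sum_mul, Finset.mul_sum, mul_assoc, ι_mul_eq_involute_mul_ι _ a']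
  rw [add_comm]

end ExteriorAlgebra

section Fields

variable {n : ℕ} {M : Type*} [TopologicalSpace M] [ChartedSpace (Model n) M] [IsManifold (𝓡 n) ∞ M]

instance (x : M) : FiniteDimensional ℝ (TangentSpace (𝓡 n) x) :=
  inferInstanceAs (FiniteDimensional ℝ (Model n))

@[simp]
theorem ofFun_apply (f : SmoothFun n M) (x : M) : (ofFun n M f).1 x = algebraMap ℝ _ (f x) :=
  rfl

@[simp]
theorem ofVField_apply (V : VField n M) (x : M) :
    (ofVField V).1 x = ExteriorAlgebra.ι ℝ (V x) :=
  rfl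

@[simp]
theorem smul_apply (f : SmoothFun n M) (X : MVF n M) (x : M) : (f • X).1 x = f x • X.1 x := by
  rw [Algebra.smul_def, Algebra.smul_def]
  rfl

@[simp]
theorem sum_apply {ι : Type*} (s : Finset ι) (X : ι → MVF n M) (x : M) :
    (∑ i ∈ s, X i).1 x = ∑ i ∈ s, (X i).1 x := by
  rw [AddSubmonoidClass.coe_finsetSum, Finset.sum_apply]

theorem neg_one_pow_mul_apply (k : ℕ) (X : MVF n M) (x : M) :
    ((-1) ^ k * X).1 x = (-1) ^ k * X.1 x :=
  rfl

@[ext]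
theorem MVF.ext {X Y : MVF n M} (h : ∀ x, X.1 x = Y.1 x) : X = Y :=
  Subtype.ext (funext h)

theorem smul_eq_ofFun_mul (f : SmoothFun n M) (X : MVF n M) : f • X = ofFun n M f * X :=
  Algebra.smul_def f X

theorem smul_one_eq_ofFun (f : SmoothFun n M) : f • (1 : MVF n M) = ofFun n M f := by
  rw [smul_eq_ofFun_mul, mul_one]

theorem ofFun_mem (f : SmoothFun n M) : ofFun n M f ∈ A n M 0 := fun x =>
  mem_exteriorPower_zero.2 ⟨f x, rfl⟩

theorem ofVField_mem (V : VField n M) : ofVField V ∈ A n M 1 := fun _ =>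
  ι_mem_exteriorPower_one _

theorem mul_mem_A {k l : ℕ} {X Y : MVF n M} (hX : X ∈ A n M k) (hY : Y ∈ A n M l) :
    X * Y ∈ A n M (k + l) := fun x =>
  mul_mem_exteriorPower (hX x) (hY x)

theorem eq_zero_of_mem_A {k : ℕ} (hk : n < k) {X : MVF n M} (hX : X ∈ A n M k) : X = 0 := by
  ext x : 1
  have hrank : Module.finrank ℝ (TangentSpace (𝓡 n) x) < k :=
    (finrank_euclideanSpace_fin (𝕜 := ℝ) (n := n)).trans_lt hk
  exact (Submodule.eq_bot_iff _).1 (exteriorPower_eq_bot_of_finrank_lt hrank) _ (hX x)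

theorem ofVField_injective : Function.Injective (ofVField : VField n M → MVF n M) := fun V W h => by
  ext1 x
  exact (ExteriorAlgebra.ι_inj ℝ _ _).1 (congrFun (congrArg Subtype.val h) x)

theorem ofVField_add (V W : VField n M) : ofVField (V + W) = ofVField V + ofVField W := by
  ext x : 1
  exact map_add (ExteriorAlgebra.ι ℝ) (V x) (W x)

theorem ofVField_fsmul (f : SmoothFun n M) (V : VField n M) :
    ofVField (fsmul f V) = f • ofVField V := by
  ext x : 1
  rw [smul_apply]
  exact map_smul (ExteriorAlgebra.ι ℝ) (f x) (V x)

theorem fsmul_const (c : ℝ) (V : VField n M) : fsmul (ContMDiffMap.const c) V = c • V :=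
  rfl

/-- The vector field underlying a field of multivectors, that is, its component of degree `1`. -/
def toVField (X : MVF n M) : VField n M :=
  ⟨fun x => ExteriorAlgebra.ιInv (X.1 x), fun x => by
    let e := trivializationAt (Model n) (TangentSpace (𝓡 n) : M → Type _) x
    let b := (EuclideanSpace.basisFun (Fin n) ℝ).toBasis
    have hcoord : ContMDiffAt (𝓡 n) 𝓘(ℝ, Model n) ∞
        (fun y => ∑ i, (b.coord i ∘ₗ ExteriorAlgebra.ιInv) (coord X.1 x y) • b i) x :=
      ContMDiffAt.sum fun i _ => (X.2 x (b.coord i ∘ₗ ExteriorAlgebra.ιInv)).smul contMDiffAt_const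
    refine (Bundle.contMDiffAt_section x).2 (hcoord.congr_of_eventuallyEq ?_)
    filter_upwards [e.open_baseSet.mem_nhds (FiberBundle.mem_baseSet_trivializationAt' x)]
      with y hy
    rw [← e.continuousLinearMapAt_apply_of_mem (R := ℝ) hy]
    simp only [LinearMap.comp_apply, Module.Basis.coord_apply, b.sum_repr, coord]
    exact (DFunLike.congr_fun
      (ExteriorAlgebra.ιInv_comp_map (e.continuousLinearMapAt ℝ y).toLinearMap) (X.1 y)).symm⟩

theorem toVField_ofVField (V : VField n M) : toVField (ofVField V) = V := by
  ext1 x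
  exact ExteriorAlgebra.ι_leftInverse (V x)

theorem ofVField_toVField {X : MVF n M} (hX : X ∈ A n M 1) : ofVField (toVField X) = X := by
  ext x : 1
  obtain ⟨v, hv⟩ : X.1 x ∈ LinearMap.range (ExteriorAlgebra.ι ℝ) := by
    simpa only [ExteriorAlgebra.exteriorPower, pow_one] using hX x
  change ExteriorAlgebra.ι ℝ (ExteriorAlgebra.ιInv (X.1 x)) = X.1 x
  rw [← hv, ExteriorAlgebra.ι_leftInverse]

theorem toVField_add (X Y : MVF n M) : toVField (X + Y) = toVField X + toVField Y := by
  ext1 y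
  exact map_add ExteriorAlgebra.ιInv (X.1 y) (Y.1 y)

theorem toVField_smul (f : SmoothFun n M) (X : MVF n M) :
    toVField (f • X) = fsmul f (toVField X) := by
  ext1 y
  exact (congrArg ExteriorAlgebra.ιInv (smul_apply f X y)).trans (map_smul _ (f y) _)

theorem isSmooth_smul {f : M → ℝ} (hf : ContMDiff (𝓡 n) 𝓘(ℝ, ℝ) ∞ f) {X : RawField n M}
    (hX : IsSmooth X) : IsSmooth fun x => f x • X x := by
  simp only [Algebra.smul_def]
  exact isSmooth_mul (isSmooth_rawOfFun hf) hX

theorem contMDiff_mvfderiv_apply (f : SmoothFun n M) (V : VField n M) :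
    ContMDiff (𝓡 n) 𝓘(ℝ, ℝ) ∞ fun x => mvfderiv (𝓡 n) f x (V x) :=
  (contMDiff_snd_tangentBundle_modelSpace ℝ 𝓘(ℝ, ℝ)).comp
    ((f.contMDiff.contMDiff_tangentMap (m := ∞) le_rfl).comp V.contMDiff)

end Fields

section ComponentwiseSmoothness

variable {H₀ H M : Type*} [NormedAddCommGroup H₀] [NormedSpace ℝ H₀] [TopologicalSpace H]
  {I : ModelWithCorners ℝ H₀ H} [TopologicalSpace M] [ChartedSpace H M]
  {E F : Type*} [AddCommGroup E] [Module ℝ E] [AddCommGroup F] [Module ℝ F]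
  {u v : M → E} {f : M → ℝ} {x : M}

variable (I) in
/-- Smoothness at `x` of a map to a finite-dimensional space on which no norm has been chosen:
the composition with every linear functional is smooth at `x`. -/
def SmoothComponentsAt (u : M → E) (x : M) : Prop :=
  ∀ φ : Module.Dual ℝ E, ContMDiffAt I 𝓘(ℝ, ℝ) ∞ (fun y => φ (u y)) x

namespace SmoothComponentsAt

theorem const (a : E) : SmoothComponentsAt I (fun _ : M => a) x := fun _ =>
  contMDiffAt_const

theorem add (hu : SmoothComponentsAt I u x) (hv : SmoothComponentsAt I v x) :
    SmoothComponentsAt I (fun y => u y + v y) x := fun φ => by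
  simp only [map_add]
  exact (hu φ).add (hv φ)

theorem smul (hf : ContMDiffAt I 𝓘(ℝ, ℝ) ∞ f x) (hu : SmoothComponentsAt I u x) :
    SmoothComponentsAt I (fun y => f y • u y) x := fun φ => by
  simp only [map_smul]
  exact hf.smul (hu φ)

theorem sum {ι : Type*} {s : Finset ι} {u : ι → M → E}
    (hu : ∀ i, SmoothComponentsAt I (u i) x) :
    SmoothComponentsAt I (fun y => ∑ i ∈ s, u i y) x := fun φ => by
  simp only [map_sum]
  exact ContMDiffAt.sum fun i _ => hu i φ

theorem map (L : E →ₗ[ℝ] F) (hu : SmoothComponentsAt I u x) :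
    SmoothComponentsAt I (fun y => L (u y)) x := fun φ =>
  hu (φ ∘ₗ L)

theorem congr_of_eventually_eq (hu : SmoothComponentsAt I u x) (h : ∀ᶠ y in 𝓝 x, v y = u y) :
    SmoothComponentsAt I v x := fun φ =>
  (hu φ).congr_of_eventuallyEq (h.mono fun y hy => by simp only [hy])

theorem mul {B : Type*} [Ring B] [Algebra ℝ B] [FiniteDimensional ℝ B] {u v : M → B}
    (hu : SmoothComponentsAt I u x) (hv : SmoothComponentsAt I v x) :
    SmoothComponentsAt I (fun y => u y * v y) x := by
  let b := Module.finBasis ℝ B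
  have hrepr : (fun y => u y * v y) =
      fun y => ∑ i, ∑ j, (b.coord i (u y) * b.coord j (v y)) • (b i * b j) := by
    funext y
    conv_lhs => rw [← b.sum_repr (u y), ← b.sum_repr (v y)]
    simp only [Finset.sum_mul_sum, smul_mul_smul_comm, Module.Basis.coord_apply]
  rw [hrepr]
  exact sum fun i => sum fun j => smul ((hu _).mul (hv _)) (const _)

theorem mdifferentiableAt (hu : SmoothComponentsAt I u x) (φ : Module.Dual ℝ E) :
    MDiffAt (fun y => φ (u y)) x :=
  (hu φ).mdifferentiableAt (by simp)

end SmoothComponentsAt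

variable [FiniteDimensional ℝ E]

variable (I) in
/-- The derivative at `x` of a map to a finite-dimensional space on which no norm has been
chosen. -/
def componentDeriv (u : M → E) (x : M) : TangentSpace I x →ₗ[ℝ] E :=
  (Module.finBasis ℝ E).equivFun.symm.toLinearMap ∘ₗ
    (mvfderiv I (fun y => (Module.finBasis ℝ E).equivFun (u y)) x).toLinearMap

theorem apply_componentDeriv (hu : SmoothComponentsAt I u x) (φ : Module.Dual ℝ E)
    (w : TangentSpace I x) :
    φ (componentDeriv I u x w) = mvfderiv I (fun y => φ (u y)) x w := by
  let e := (Module.finBasis ℝ E).equivFun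
  let ψ := LinearMap.toContinuousLinearMap (φ ∘ₗ e.symm.toLinearMap)
  have hφ : (fun y => φ (u y)) = ψ ∘ fun y => e (u y) := by
    funext y
    simp only [ψ, Function.comp_apply, LinearMap.coe_toContinuousLinearMap', LinearMap.comp_apply,
      LinearEquiv.coe_coe, e.symm_apply_apply]
  have hψ : mvfderiv 𝓘(ℝ, Fin _ → ℝ) ψ (e (u x)) = ψ := by
    rw [mvfderiv, mfderiv_eq_fderiv, ψ.fderiv]
    rfl
  have he : MDifferentiableAt I 𝓘(ℝ, Fin _ → ℝ) (fun y => e (u y)) x :=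
    (contMDiffAt_pi_space.2 fun i => hu ((Module.finBasis ℝ E).coord i)).mdifferentiableAt
      (n := ∞) (by simp)
  rw [hφ, mvfderiv_comp_apply x ψ.differentiableAt.mdifferentiableAt he, hψ]
  rfl

theorem componentDeriv_eq_iff (hu : SmoothComponentsAt I u x) {w : TangentSpace I x} {a : E} :
    componentDeriv I u x w = a ↔
      ∀ φ : Module.Dual ℝ E, mvfderiv I (fun y => φ (u y)) x w = φ a := by
  simp only [← apply_componentDeriv hu]
  rw [← sub_eq_zero, ← Module.forall_dual_apply_eq_zero_iff ℝ]
  simp only [map_sub, sub_eq_zero]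

theorem componentDeriv_add (hu : SmoothComponentsAt I u x) (hv : SmoothComponentsAt I v x) :
    componentDeriv I (fun y => u y + v y) x = componentDeriv I u x + componentDeriv I v x := by
  ext w
  refine (componentDeriv_eq_iff (hu.add hv)).2 fun φ => ?_
  simp only [map_add, LinearMap.add_apply, apply_componentDeriv, hu, hv]
  exact DFunLike.congr_fun (mvfderiv_add (hu.mdifferentiableAt φ) (hv.mdifferentiableAt φ)) w

theorem componentDeriv_smul (hf : ContMDiffAt I 𝓘(ℝ, ℝ) ∞ f x) (hu : SmoothComponentsAt I u x) :
    componentDeriv I (fun y => f y • u y) x =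
      (mvfderiv I f x).toLinearMap.smulRight (u x) + f x • componentDeriv I u x := by
  ext w
  refine (componentDeriv_eq_iff (hu.smul hf)).2 fun φ => ?_
  simp only [map_add, map_smul, LinearMap.add_apply, LinearMap.smulRight_apply,
    LinearMap.smul_apply, apply_componentDeriv, hu]
  rw [add_comm]
  exact DFunLike.congr_fun
    (mvfderiv_smul (hf.mdifferentiableAt (by simp)) (hu.mdifferentiableAt φ)) w

theorem componentDeriv_congr (h : ∀ᶠ y in 𝓝 x, u y = v y) :
    componentDeriv I u x = componentDeriv I v x := by
  have he : (fun y => (Module.finBasis ℝ E).equivFun (u y)) =ᶠ[𝓝 x]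
      fun y => (Module.finBasis ℝ E).equivFun (v y) :=
    h.mono fun y hy => congrArg (Module.finBasis ℝ E).equivFun hy
  have hd : mvfderiv I (fun y => (Module.finBasis ℝ E).equivFun (u y)) x =
      mvfderiv I (fun y => (Module.finBasis ℝ E).equivFun (v y)) x :=
    he.mfderiv_eq
  rw [componentDeriv, componentDeriv, hd]

theorem componentDeriv_const (a : E) : componentDeriv I (fun _ : M => a) x = 0 := by
  rw [componentDeriv, mvfderiv_const]
  exact LinearMap.comp_zero _

theorem componentDeriv_sum {ι : Type*} {s : Finset ι} {u : ι → M → E}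
    (hu : ∀ i, SmoothComponentsAt I (u i) x) :
    componentDeriv I (fun y => ∑ i ∈ s, u i y) x = ∑ i ∈ s, componentDeriv I (u i) x := by
  classical
  induction s using Finset.induction_on with
  | empty =>
    simp only [Finset.sum_empty]
    exact componentDeriv_const 0
  | insert i s hi ih =>
    simp only [Finset.sum_insert hi]
    rw [componentDeriv_add (hu i) (.sum hu), ih]

theorem componentDeriv_map [FiniteDimensional ℝ F] (L : E →ₗ[ℝ] F)
    (hu : SmoothComponentsAt I u x) :
    componentDeriv I (fun y => L (u y)) x = L ∘ₗ componentDeriv I u x := by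
  ext w
  exact (componentDeriv_eq_iff (hu.map L)).2 fun φ => (apply_componentDeriv hu (φ ∘ₗ L) w).symm

theorem componentDeriv_mem (hu : SmoothComponentsAt I u x) {W : Submodule ℝ E}
    (h : ∀ y, u y ∈ W) (w : TangentSpace I x) : componentDeriv I u x w ∈ W := by
  rw [← Subspace.forall_mem_dualAnnihilator_apply_eq_zero_iff]
  intro φ hφ
  have hzero : (fun y => φ (u y)) = 0 :=
    funext fun y => (Submodule.mem_dualAnnihilator φ).1 hφ _ (h y)
  rw [apply_componentDeriv hu, hzero, mvfderiv_zero]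
  rfl

theorem componentDeriv_mul {B : Type*} [Ring B] [Algebra ℝ B] [FiniteDimensional ℝ B]
    {u v : M → B} (hu : SmoothComponentsAt I u x) (hv : SmoothComponentsAt I v x)
    (w : TangentSpace I x) :
    componentDeriv I (fun y => u y * v y) x w =
      componentDeriv I u x w * v x + u x * componentDeriv I v x w := by
  let b := Module.finBasis ℝ B
  have hrepr : (fun y => u y * v y) = fun y => ∑ i, b.coord i (u y) • (b i * v y) := by
    funext y
    conv_lhs => rw [← b.sum_repr (u y)]
    simp only [Finset.sum_mul, smul_mul_assoc, Module.Basis.coord_apply]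
  have hv' (i) : SmoothComponentsAt I (fun y => b i * v y) x := hv.map (LinearMap.mulLeft ℝ (b i))
  have hterm (i) : componentDeriv I (fun y => b.coord i (u y) • (b i * v y)) x w =
      b.coord i (componentDeriv I u x w) • b i * v x +
        b.coord i (u x) • b i * componentDeriv I v x w := by
    have hmap : componentDeriv I (fun y => b i * v y) x = LinearMap.mulLeft ℝ (b i) ∘ₗ
        componentDeriv I v x := componentDeriv_map (LinearMap.mulLeft ℝ (b i)) hv
    rw [componentDeriv_smul (hu _) (hv' i), hmap, apply_componentDeriv hu, smul_mul_assoc,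
      smul_mul_assoc]
    rfl
  rw [hrepr, componentDeriv_sum fun i => .smul (hu _) (hv' i), LinearMap.sum_apply,
    Finset.sum_congr rfl fun i _ => hterm i, Finset.sum_add_distrib, ← Finset.sum_mul,
    ← Finset.sum_mul]
  simp only [Module.Basis.coord_apply, b.sum_repr]

end ComponentwiseSmoothness

section LocalExtension

variable {n : ℕ} {M : Type*} [TopologicalSpace M] [ChartedSpace (Model n) M] [IsManifold (𝓡 n) ∞ M]
  {x y z : M}

/-- The trivialization of `TM` around `x`. -/
abbrev triv (x : M) : Bundle.Trivialization (Model n) (Bundle.TotalSpace.proj :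
    Bundle.TotalSpace (Model n) (TangentSpace (𝓡 n) : M → Type _) → M) :=
  trivializationAt (Model n) (TangentSpace (𝓡 n) : M → Type _) x

theorem mem_baseSet_triv (x : M) : x ∈ (triv (n := n) x).baseSet :=
  FiberBundle.mem_baseSet_trivializationAt' x

theorem eventually_mem_baseSet_triv (hy : y ∈ (triv (n := n) x).baseSet) :
    ∀ᶠ z in 𝓝 y, z ∈ (triv (n := n) x).baseSet :=
  (triv (n := n) x).open_baseSet.mem_nhds hy

/-- The parallel transport from `y` to `z` for the flat connection given by the trivialization of
`TM` around `x`. It is only meaningful when `y` and `z` belong to the domain of the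
trivialization. -/
def transport (x y z : M) : TangentSpace (𝓡 n) y →ₗ[ℝ] TangentSpace (𝓡 n) z :=
  ((triv (n := n) x).symmL ℝ z).toLinearMap ∘ₗ
    ((triv (n := n) x).continuousLinearMapAt ℝ y).toLinearMap

theorem transport_self (hy : y ∈ (triv (n := n) x).baseSet) :
    transport x y y = (LinearMap.id : TangentSpace (𝓡 n) y →ₗ[ℝ] _) :=
  LinearMap.ext fun v => (triv (n := n) x).symmL_continuousLinearMapAt hy v

theorem transport_comp_transport (hy : y ∈ (triv (n := n) x).baseSet) (z w : M) :
    transport (n := n) x y w ∘ₗ transport x z y = transport x z w :=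
  LinearMap.ext fun v => congrArg ((triv (n := n) x).symmL ℝ w)
    ((triv (n := n) x).continuousLinearMapAt_symmL hy ((triv x).continuousLinearMapAt ℝ z v))

/-- The multivector `X y`, for `y` near `x`, transported to `x` by means of the trivialization
around `x`. -/
def localRep (x : M) (X : RawField n M) (y : M) : ExteriorAlgebra ℝ (TangentSpace (𝓡 n) x) :=
  ExteriorAlgebra.map (transport x y x) (X y)

theorem localRep_self (x : M) (X : RawField n M) : localRep x X x = X x := by
  rw [localRep, transport_self (mem_baseSet_triv x), ExteriorAlgebra.map_id]
  rfl

theorem localRep_eq_map_coord (x : M) (X : RawField n M) (y : M) :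
    localRep x X y =
      ExteriorAlgebra.map ((triv (n := n) x).symmL ℝ x).toLinearMap (coord X x y) := by
  rw [localRep, transport, ← ExteriorAlgebra.map_comp_map]
  rfl

theorem map_transport_localRep (hy : y ∈ (triv (n := n) x).baseSet) (X : RawField n M) :
    ExteriorAlgebra.map (transport x x y) (localRep x X y) = X y := by
  rw [localRep, ← AlgHom.comp_apply, ExteriorAlgebra.map_comp_map,
    transport_comp_transport (mem_baseSet_triv x), transport_self hy, ExteriorAlgebra.map_id]
  rfl

theorem smoothComponentsAt_localRep_self (X : MVF n M) (x : M) :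
    SmoothComponentsAt (𝓡 n) (localRep x X.1) x := by
  rw [funext (localRep_eq_map_coord x X.1)]
  exact SmoothComponentsAt.map (ExteriorAlgebra.map _).toLinearMap (X.2 x)

theorem localRep_mem {k : ℕ} {X : RawField n M}
    (hX : X y ∈ ⋀[ℝ]^k (TangentSpace (𝓡 n) y)) :
    localRep x X y ∈ ⋀[ℝ]^k (TangentSpace (𝓡 n) x) :=
  map_mem_exteriorPower _ hX

theorem smoothComponentsAt_coord_ofVField (hy : y ∈ (triv (n := n) x).baseSet)
    (V : VField n M) : SmoothComponentsAt (𝓡 n) (coord (ofVField V).1 x) y := by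
  intro φ
  have hV := ((triv (n := n) x).contMDiffAt_section_iff hy).1 (V.contMDiff y)
  let ψ : Model n →L[ℝ] ℝ := LinearMap.toContinuousLinearMap (φ ∘ₗ ExteriorAlgebra.ι ℝ)
  refine (ψ.contMDiff.contMDiffAt.comp y hV).congr_of_eventuallyEq ?_
  filter_upwards [eventually_mem_baseSet_triv hy] with z hz
  rw [coord, ofVField_apply, ExteriorAlgebra.map_apply_ι]
  exact congrArg (fun v => φ (ExteriorAlgebra.ι ℝ v))
    ((triv (n := n) x).continuousLinearMapAt_apply_of_mem (R := ℝ) hz (V z))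

/-- The wedge product of a list of vector fields. -/
def wedge (L : List (VField n M)) : MVF n M :=
  (L.map ofVField).prod

theorem wedge_nil : wedge ([] : List (VField n M)) = 1 :=
  rfl

theorem wedge_cons (V : VField n M) (L : List (VField n M)) :
    wedge (V :: L) = ofVField V * wedge L :=
  List.prod_cons

theorem wedge_mem (L : List (VField n M)) : wedge L ∈ A n M L.length := by
  induction L with
  | nil =>
    rw [wedge_nil, ← map_one (ofFun n M)]
    exact ofFun_mem 1
  | cons V L ih =>
    rw [wedge_cons, List.length_cons, add_comm]
    exact mul_mem_A (ofVField_mem V) ih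

variable [T2Space M]

theorem exists_bump {s : Set M} (hs : s ∈ 𝓝 x) :
    ∃ ρ : SmoothFun n M, ρ x = 1 ∧ ∀ z ∉ s, ρ z = 0 := by
  obtain ⟨f, hf, -⟩ := (SmoothBumpFunction.nhds_basis_support (I := 𝓡 n) hs).mem_iff.1 hs
  refine ⟨⟨f, f.contMDiff⟩, f.eq_one, fun z hz => ?_⟩
  by_contra h
  exact hz (hf (subset_tsupport _ h))

theorem exists_bump_smul_eq {X Y : MVF n M} (h : ∀ᶠ y in 𝓝 x, X.1 y = Y.1 y) :
    ∃ ρ : SmoothFun n M, ρ x = 1 ∧ ρ • X = ρ • Y := by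
  obtain ⟨ρ, hρ, hzero⟩ := exists_bump (n := n) h
  refine ⟨ρ, hρ, MVF.ext fun y => ?_⟩
  by_cases hy : X.1 y = Y.1 y
  · rw [smul_apply, smul_apply, hy]
  · rw [smul_apply, smul_apply, hzero y hy, zero_smul, zero_smul]

/-- An arbitrarily chosen bump function at `x`. -/
def bump (x : M) : SmoothBumpFunction (𝓡 n) x :=
  Classical.arbitrary _

/-- The extension of a tangent vector at `x` to a vector field that is, near `x`, constant in the
trivialization of `TM` around `x`. -/
def extVector (x : M) : TangentSpace (𝓡 n) x →ₗ[ℝ] VField n M where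
  toFun v := ⟨fun y => bump (n := n) x y • transport x x y v, by
    refine ContMDiffOn.smul_section_of_tsupport (u := (triv (n := n) x).baseSet)
      (bump x).contMDiff.contMDiffOn (triv x).open_baseSet
      (bump x).tsupport_subset_chartAt_source ?_
    rw [(triv (n := n) x).contMDiffOn_section_baseSet_iff]
    refine (contMDiffOn_const (c := (triv x).continuousLinearMapAt ℝ x v)).congr fun y hy => ?_
    rw [← (triv (n := n) x).continuousLinearMapAt_apply_of_mem (R := ℝ) hy]
    exact (triv (n := n) x).continuousLinearMapAt_symmL hy _⟩
  map_add' v w := by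
    ext1 y
    exact (congrArg (bump (n := n) x y • ·) (map_add _ v w)).trans (smul_add _ _ _)
  map_smul' c v := by
    ext1 y
    exact (congrArg (bump (n := n) x y • ·) (map_smul _ c v)).trans (smul_comm _ _ _)

theorem eventually_extVector_eq (x : M) :
    ∀ᶠ y in 𝓝 x, ∀ v : TangentSpace (𝓡 n) x, extVector x v y = transport x x y v := by
  filter_upwards [(bump (n := n) x).eventuallyEq_one] with y hy v
  exact (congrArg (· • transport x x y v) hy).trans (one_smul _ _)

/-- The homomorphism `extend`, before it is known to take its values in smooth fields. -/
def rawExtend (x : M) : ExteriorAlgebra ℝ (TangentSpace (𝓡 n) x) →ₐ[ℝ] RawField n M :=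
  ExteriorAlgebra.lift ℝ ⟨
    { toFun := fun v => (ofVField (extVector x v)).1
      map_add' := fun v w => by rw [map_add, ofVField_add]; rfl
      map_smul' := fun c v => by
        rw [map_smul, ← fsmul_const, ofVField_fsmul]
        exact funext fun y => smul_apply _ _ y },
    fun v => funext fun y => ExteriorAlgebra.ι_sq_zero _⟩

theorem rawExtend_ι (x : M) (v : TangentSpace (𝓡 n) x) :
    rawExtend x (ExteriorAlgebra.ι ℝ v) = (ofVField (extVector x v)).1 :=
  ExteriorAlgebra.lift_ι_apply ℝ _ _ v

theorem smoothComponentsAt_coord_rawExtend (hz : z ∈ (triv (n := n) y).baseSet)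
    (ξ : ExteriorAlgebra ℝ (TangentSpace (𝓡 n) x)) :
    SmoothComponentsAt (𝓡 n) (coord (rawExtend x ξ) y) z := by
  induction ξ using ExteriorAlgebra.induction with
  | algebraMap r =>
    have hconst : coord (rawExtend (n := n) x (algebraMap ℝ _ r)) y =
        fun _ => algebraMap ℝ _ r := by
      funext w
      rw [AlgHom.commutes]
      exact AlgHom.commutes _ r
    rw [hconst]
    exact .const _
  | ι v =>
    rw [rawExtend_ι]
    exact smoothComponentsAt_coord_ofVField hz _
  | mul a b ha hb =>
    have hmul : coord (rawExtend x (a * b)) y =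
        fun w => coord (rawExtend x a) y w * coord (rawExtend x b) y w := by
      funext w
      rw [map_mul]
      exact map_mul (ExteriorAlgebra.map _) _ _
    rw [hmul]
    exact ha.mul hb
  | add a b ha hb =>
    have hadd : coord (rawExtend x (a + b)) y =
        fun w => coord (rawExtend x a) y w + coord (rawExtend x b) y w := by
      funext w
      rw [map_add]
      exact map_add (ExteriorAlgebra.map _) _ _
    rw [hadd]
    exact ha.add hb

/-- The extension of a multivector at `x` to a multivector field that is, near `x`, constant in
the trivialization of `TM` around `x`. -/
def extend (x : M) : ExteriorAlgebra ℝ (TangentSpace (𝓡 n) x) →+* MVF n M :=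
  (rawExtend x).toRingHom.codRestrict (MVF n M) fun ξ y =>
    smoothComponentsAt_coord_rawExtend (mem_baseSet_triv y) ξ

theorem extend_ι (x : M) (v : TangentSpace (𝓡 n) x) :
    extend x (ExteriorAlgebra.ι ℝ v) = ofVField (extVector x v) :=
  Subtype.ext (rawExtend_ι x v)

theorem extend_smul (x : M) (c : ℝ) (ξ : ExteriorAlgebra ℝ (TangentSpace (𝓡 n) x)) :
    extend (n := n) x (c • ξ) = (ContMDiffMap.const c : SmoothFun n M) • extend x ξ := by
  ext y : 1
  rw [smul_apply]
  exact congrFun (map_smul (rawExtend x) c ξ) y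

theorem extend_mem {k : ℕ} {ξ : ExteriorAlgebra ℝ (TangentSpace (𝓡 n) x)}
    (hξ : ξ ∈ ⋀[ℝ]^k (TangentSpace (𝓡 n) x)) : extend x ξ ∈ A n M k := by
  induction k generalizing ξ with
  | zero =>
    obtain ⟨r, rfl⟩ := mem_exteriorPower_zero.1 hξ
    rw [Algebra.algebraMap_eq_smul_one, extend_smul, map_one, smul_one_eq_ofFun]
    exact ofFun_mem _
  | succ k ih =>
    refine exteriorPower_succ_induction hξ (fun a ha v => ?_) fun a b ha hb => ?_
    · rw [map_mul, extend_ι]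
      exact mul_mem_A (ih ha) (ofVField_mem _)
    · rw [map_add]
      exact Submodule.add_mem _ ha hb

theorem eventually_extend_eq (x : M) :
    ∀ᶠ y in 𝓝 x, ∀ ξ : ExteriorAlgebra ℝ (TangentSpace (𝓡 n) x),
      (extend x ξ).1 y = ExteriorAlgebra.map (transport x x y) ξ := by
  filter_upwards [eventually_extVector_eq (n := n) x] with y hy ξ
  have hext : (Pi.evalAlgHom ℝ _ y).comp (rawExtend (n := n) x) =
      ExteriorAlgebra.map (transport x x y) := by
    ext v
    simp [rawExtend_ι, hy]
  exact DFunLike.congr_fun hext ξ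

theorem extend_self (x : M) (ξ : ExteriorAlgebra ℝ (TangentSpace (𝓡 n) x)) :
    (extend x ξ).1 x = ξ := by
  rw [(eventually_extend_eq x).self_of_nhds, transport_self (mem_baseSet_triv x),
    ExteriorAlgebra.map_id]
  rfl

theorem eventually_localRep_extend (x : M) (ξ : ExteriorAlgebra ℝ (TangentSpace (𝓡 n) x)) :
    ∀ᶠ y in 𝓝 x, localRep x (extend x ξ).1 y = ξ := by
  filter_upwards [eventually_extend_eq (n := n) x,
    eventually_mem_baseSet_triv (mem_baseSet_triv (n := n) x)] with y hext hy
  rw [localRep, hext, ← AlgHom.comp_apply, ExteriorAlgebra.map_comp_map,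
    transport_comp_transport hy, transport_self (mem_baseSet_triv x), ExteriorAlgebra.map_id]
  rfl

theorem eventually_eq_sum_extend (X : RawField n M) {ι : Type*} [Fintype ι]
    (b : Module.Basis ι ℝ (ExteriorAlgebra ℝ (TangentSpace (𝓡 n) x))) :
    ∀ᶠ y in 𝓝 x, X y = ∑ i, b.coord i (localRep x X y) • (extend x (b i)).1 y := by
  filter_upwards [eventually_extend_eq (n := n) x,
    eventually_mem_baseSet_triv (mem_baseSet_triv (n := n) x)] with y hext hy
  simp only [hext, ← map_smul, ← map_sum, Module.Basis.coord_apply, b.sum_repr]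
  exact (map_transport_localRep hy X).symm

theorem smoothComponentsAt_localRep (X : MVF n M) (hy : y ∈ (triv (n := n) x).baseSet) :
    SmoothComponentsAt (𝓡 n) (localRep x X.1) y := by
  let b := Module.finBasis ℝ (ExteriorAlgebra ℝ (TangentSpace (𝓡 n) y))
  have hsum : SmoothComponentsAt (𝓡 n)
      (fun z => ∑ i, b.coord i (localRep y X.1 z) • coord (extend y (b i)).1 x z) y :=
    .sum fun i => .smul (smoothComponentsAt_localRep_self X y _)
      (smoothComponentsAt_coord_rawExtend hy _)
  rw [funext (localRep_eq_map_coord x X.1)]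
  refine .map (ExteriorAlgebra.map _).toLinearMap (hsum.congr_of_eventually_eq ?_)
  filter_upwards [eventually_eq_sum_extend X.1 b] with z hz
  rw [coord, hz, map_sum]
  simp only [map_smul]
  rfl

theorem exists_eventually_eq_sum (X : MVF n M) {ι : Type*} [Fintype ι]
    (b : Module.Basis ι ℝ (ExteriorAlgebra ℝ (TangentSpace (𝓡 n) x))) :
    ∃ f : ι → SmoothFun n M, (∀ i, f i x = b.coord i (X.1 x)) ∧
      ∀ᶠ y in 𝓝 x, X.1 y = (∑ i, f i • extend x (b i)).1 y := by
  let ρ := bump (n := n) x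
  let f (i : ι) : SmoothFun n M := ⟨fun y => ρ y • b.coord i (localRep x X.1 y), ρ.contMDiff_smul
    fun y hy => (smoothComponentsAt_localRep (x := x) X hy (b.coord i)).contMDiffWithinAt⟩
  have hf (i : ι) {y : M} (hy : ρ y = 1) : f i y = b.coord i (localRep x X.1 y) :=
    (congrArg (· • _) hy).trans (one_smul _ _)
  refine ⟨f, fun i => by rw [hf i ρ.eq_one, localRep_self], ?_⟩
  filter_upwards [eventually_eq_sum_extend X.1 b, ρ.eventuallyEq_one] with y hy hρ
  simp only [hy, sum_apply, smul_apply, hf _ hρ]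

theorem extend_ιMulti (x : M) {k : ℕ} (v : Fin k → TangentSpace (𝓡 n) x) :
    extend x (ExteriorAlgebra.ιMulti ℝ k v) = wedge (List.ofFn fun i => extVector x (v i)) := by
  rw [ExteriorAlgebra.ιMulti_apply, map_list_prod, wedge, List.map_ofFn, List.map_ofFn]
  exact congrArg (fun u => (List.ofFn u).prod) (funext fun i => extend_ι x (v i))

variable (n M) in
/-- The `C^∞(M)`-submodule generated by the wedge products of vector fields. Locally every
multivector field belongs to it. -/
def wedgeSpan : Submodule (SmoothFun n M) (MVF n M) :=
  Submodule.span _ (Set.range wedge)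

theorem extend_mem_wedgeSpan (x : M) (ξ : ExteriorAlgebra ℝ (TangentSpace (𝓡 n) x)) :
    extend x ξ ∈ wedgeSpan n M := by
  have hξ : ξ ∈ Submodule.span ℝ (Set.range fun v : Σ k, (Fin k → TangentSpace (𝓡 n) x) =>
      ExteriorAlgebra.ιMulti ℝ v.1 v.2) := by
    rw [ExteriorAlgebra.ιMulti_span]
    trivial
  induction hξ using Submodule.span_induction with
  | mem a ha =>
    obtain ⟨v, rfl⟩ := ha
    exact Submodule.subset_span ⟨_, (extend_ιMulti x v.2).symm⟩
  | zero => rw [map_zero]; exact Submodule.zero_mem _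
  | add a b _ _ ha hb => rw [map_add]; exact Submodule.add_mem _ ha hb
  | smul c a _ ha => rw [extend_smul]; exact Submodule.smul_mem _ _ ha

theorem exists_mem_wedgeSpan_eventually_eq (X : MVF n M) (x : M) :
    ∃ Y ∈ wedgeSpan n M, ∀ᶠ y in 𝓝 x, X.1 y = Y.1 y := by
  obtain ⟨f, -, hf⟩ := exists_eventually_eq_sum (x := x) X (Module.finBasis ℝ _)
  exact ⟨_, Submodule.sum_mem _ fun i _ => Submodule.smul_mem _ _ (extend_mem_wedgeSpan x _), hf⟩

end LocalExtension

section Tensoriality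

variable {n : ℕ} {M : Type*} [TopologicalSpace M] [ChartedSpace (Model n) M] [IsManifold (𝓡 n) ∞ M]
  {x : M} {W : Type*} [AddCommGroup W] [Module ℝ W]

/-- The additive maps `T` from multivector fields to a vector space such that
`T (f • X) = f x • T X`. -/
abbrev TensorialMap (x : M) (W : Type*) [AddCommGroup W] [Module ℝ W] : Type _ :=
  MVF n M →ₛₗ[(ContMDiffMap.evalRingHom x : SmoothFun n M →+* ℝ)] W

theorem TensorialMap.map_smul (T : TensorialMap (n := n) x W) (f : SmoothFun n M) (X : MVF n M) :
    T (f • X) = f x • T X :=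
  map_smulₛₗ T f X

variable [T2Space M]

theorem TensorialMap.eq_of_eventually_eq (T : TensorialMap (n := n) x W) {X Y : MVF n M}
    (h : ∀ᶠ y in 𝓝 x, X.1 y = Y.1 y) : T X = T Y := by
  obtain ⟨ρ, hρ, hXY⟩ := exists_bump_smul_eq h
  rw [← one_smul ℝ (T X), ← one_smul ℝ (T Y), ← hρ, ← T.map_smul, ← T.map_smul, hXY]

theorem TensorialMap.map_extend_smul (T : TensorialMap (n := n) x W) (r : ℝ)
    (ξ : ExteriorAlgebra ℝ (TangentSpace (𝓡 n) x)) :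
    T (extend x (r • ξ)) = r • T (extend x ξ) := by
  rw [extend_smul, T.map_smul]
  rfl

theorem TensorialMap.apply_extend (T : TensorialMap (n := n) x W) (X : MVF n M) :
    T (extend x (X.1 x)) = T X := by
  let b := Module.finBasis ℝ (ExteriorAlgebra ℝ (TangentSpace (𝓡 n) x))
  obtain ⟨f, hfx, hf⟩ := exists_eventually_eq_sum X b
  rw [T.eq_of_eventually_eq hf, ← b.sum_repr (X.1 x), map_sum, map_sum, map_sum]
  refine Finset.sum_congr rfl fun i _ => ?_
  rw [T.map_extend_smul, T.map_smul, hfx, b.coord_apply]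

theorem TensorialMap.ext_wedge {T T' : TensorialMap (n := n) x W}
    (h : ∀ L, T (wedge L) = T' (wedge L)) : T = T' := by
  refine LinearMap.ext fun X => ?_
  obtain ⟨Y, hY, hXY⟩ := exists_mem_wedgeSpan_eventually_eq X x
  rw [T.eq_of_eventually_eq hXY, T'.eq_of_eventually_eq hXY]
  exact LinearMap.eqOn_span (Set.forall_mem_range.2 h) hY

theorem apply_extVector_of_tensorial {T : VField n M → W} (add : ∀ V V', T (V + V') = T V + T V')
    (smul : ∀ f V, T (fsmul f V) = f x • T V) (V : VField n M) : T (extVector x (V x)) = T V := by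
  let T' : TensorialMap (n := n) x W :=
    { toFun := fun X => T (toVField X)
      map_add' := fun X Y => by rw [toVField_add, add]
      map_smul' := fun f X => by rw [toVField_smul, smul]; rfl }
  have h := T'.apply_extend (ofVField V)
  rw [ofVField_apply, extend_ι] at h
  simpa only [T', LinearMap.coe_mk, AddHom.coe_mk, toVField_ofVField] using h

theorem isSmooth_of_wedge {T : MVF n M → RawField n M}
    (hcongr : ∀ {X Y x}, (∀ᶠ y in 𝓝 x, X.1 y = Y.1 y) → T X x = T Y x)
    (hadd : ∀ X Y, T (X + Y) = T X + T Y)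
    (hsmul : ∀ (f : SmoothFun n M) X, IsSmooth (T X) → IsSmooth (T (f • X)))
    (hwedge : ∀ L, IsSmooth (T (wedge L))) (X : MVF n M) : IsSmooth (T X) := by
  have hspan {Y : MVF n M} (hY : Y ∈ wedgeSpan n M) : IsSmooth (T Y) := by
    induction hY using Submodule.span_induction with
    | mem a ha => obtain ⟨L, rfl⟩ := ha; exact hwedge L
    | zero =>
      have hzero : T 0 = 0 := left_eq_add.1 ((congrArg T (add_zero 0)).symm.trans (hadd 0 0))
      rw [hzero]
      exact (MVF n M).zero_mem
    | add a b _ _ ha hb => rw [hadd]; exact isSmooth_add ha hb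
    | smul f a _ ha => exact hsmul f a ha
  intro x
  obtain ⟨Y, hY, hXY⟩ := exists_mem_wedgeSpan_eventually_eq X x
  refine SmoothComponentsAt.congr_of_eventually_eq (hspan hY x) ?_
  exact hXY.eventually_nhds.mono fun y hy => by rw [coord, coord, hcongr hy]

end Tensoriality

section InducedConnection

variable {n : ℕ} {M : Type*} [TopologicalSpace M] [ChartedSpace (Model n) M] [IsManifold (𝓡 n) ∞ M]

/-- The derivative at `x` of a multivector field, with respect to the flat connection given by the
trivialization of `TM` around `x`. -/
def flatDeriv (x : M) (Y : MVF n M) :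
    TangentSpace (𝓡 n) x →ₗ[ℝ] ExteriorAlgebra ℝ (TangentSpace (𝓡 n) x) :=
  componentDeriv (𝓡 n) (localRep x Y.1) x

theorem flatDeriv_add (x : M) (Y Z : MVF n M) :
    flatDeriv x (Y + Z) = flatDeriv x Y + flatDeriv x Z := by
  have hadd : localRep x (Y + Z).1 = fun y => localRep x Y.1 y + localRep x Z.1 y :=
    funext fun y => map_add (ExteriorAlgebra.map _) (Y.1 y) (Z.1 y)
  rw [flatDeriv, hadd]
  exact componentDeriv_add (smoothComponentsAt_localRep_self Y x)
    (smoothComponentsAt_localRep_self Z x)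

theorem flatDeriv_mul (x : M) (Y Z : MVF n M) (v : TangentSpace (𝓡 n) x) :
    flatDeriv x (Y * Z) v = flatDeriv x Y v * Z.1 x + Y.1 x * flatDeriv x Z v := by
  have hmul : localRep x (Y * Z).1 = fun y => localRep x Y.1 y * localRep x Z.1 y :=
    funext fun y => map_mul (ExteriorAlgebra.map _) (Y.1 y) (Z.1 y)
  rw [flatDeriv, hmul, componentDeriv_mul (smoothComponentsAt_localRep_self Y x)
    (smoothComponentsAt_localRep_self Z x), localRep_self, localRep_self]
  rfl

theorem flatDeriv_ofFun (x : M) (f : SmoothFun n M) :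
    flatDeriv x (ofFun n M f) = (mvfderiv (𝓡 n) f x).toLinearMap.smulRight 1 := by
  have hf : localRep x (ofFun n M f).1 = fun y => f y • 1 := by
    funext y
    rw [← Algebra.algebraMap_eq_smul_one]
    exact AlgHom.commutes _ (f y)
  rw [flatDeriv, hf, componentDeriv_smul f.contMDiff.contMDiffAt (.const 1), componentDeriv_const,
    smul_zero, add_zero]

theorem flatDeriv_mem {x : M} {l : ℕ} {Y : MVF n M} (hY : Y ∈ A n M l)
    (v : TangentSpace (𝓡 n) x) : flatDeriv x Y v ∈ ⋀[ℝ]^l (TangentSpace (𝓡 n) x) :=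
  componentDeriv_mem (smoothComponentsAt_localRep_self Y x) (fun y => localRep_mem (hY y)) v

theorem flatDeriv_congr {x : M} {Y Z : MVF n M} (h : ∀ᶠ y in 𝓝 x, Y.1 y = Z.1 y) :
    flatDeriv x Y = flatDeriv x Z :=
  componentDeriv_congr (h.mono fun y hy => by rw [localRep, localRep, hy])

/-- A basis of the tangent space, needed only to apply `contract`. -/
abbrev tangentBasis (x : M) :
    Module.Basis (Fin (Module.finrank ℝ (TangentSpace (𝓡 n) x))) ℝ (TangentSpace (𝓡 n) x) :=
  Module.finBasis ℝ _

variable [T2Space M]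

theorem flatDeriv_extend (x : M) (ξ : ExteriorAlgebra ℝ (TangentSpace (𝓡 n) x)) :
    flatDeriv x (extend x ξ) = 0 := by
  rw [flatDeriv, componentDeriv_congr (eventually_localRep_extend x ξ), componentDeriv_const]

namespace AffineConnection

variable (c : AffineConnection n M)

/-- The Christoffel symbols of `c` at `x` in the trivialization of `TM` around `x`. -/
def christoffel (x : M) :
    TangentSpace (𝓡 n) x →ₗ[ℝ] TangentSpace (𝓡 n) x →ₗ[ℝ] TangentSpace (𝓡 n) x :=
  LinearMap.mk₂ ℝ (fun v w => c.toFun (extVector x v) (extVector x w) x)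
    (fun v v' w => by rw [map_add, c.add_left]; rfl)
    (fun r v w => by rw [map_smul, ← fsmul_const, c.smul_left]; rfl)
    (fun v w w' => by rw [map_add, c.add_right]; rfl)
    (fun r v w => by rw [map_smul, c.const_smul_right]; rfl)

/-- The covariant derivative at `x` of a multivector field, in all directions. It acts as a
derivation for the wedge product. -/
def covDeriv (x : M) (Y : MVF n M) :
    TangentSpace (𝓡 n) x →ₗ[ℝ] ExteriorAlgebra ℝ (TangentSpace (𝓡 n) x) :=
  flatDeriv x Y + (contract (tangentBasis x)).flip (Y.1 x) ∘ₗ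
    (c.christoffel x).compr₂ (ExteriorAlgebra.ι ℝ)

theorem covDeriv_apply (x : M) (Y : MVF n M) (v : TangentSpace (𝓡 n) x) :
    c.covDeriv x Y v = flatDeriv x Y v +
      contract (tangentBasis x) (ExteriorAlgebra.ι ℝ ∘ₗ c.christoffel x v) (Y.1 x) :=
  rfl

theorem covDeriv_add (x : M) (Y Z : MVF n M) :
    c.covDeriv x (Y + Z) = c.covDeriv x Y + c.covDeriv x Z := by
  ext v
  have hadd : (Y + Z).1 x = Y.1 x + Z.1 x := rfl
  simp only [covDeriv_apply, flatDeriv_add, LinearMap.add_apply, hadd, map_add]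
  abel

theorem covDeriv_mul (x : M) (Y Z : MVF n M) (v : TangentSpace (𝓡 n) x) :
    c.covDeriv x (Y * Z) v = c.covDeriv x Y v * Z.1 x + Y.1 x * c.covDeriv x Z v := by
  have hmul : (Y * Z).1 x = Y.1 x * Z.1 x := rfl
  simp only [covDeriv_apply, flatDeriv_mul, hmul, contract_ι_comp_mul]
  noncomm_ring

theorem covDeriv_ofFun (x : M) (f : SmoothFun n M) :
    c.covDeriv x (ofFun n M f) = (mvfderiv (𝓡 n) f x).toLinearMap.smulRight 1 := by
  ext v
  rw [covDeriv_apply, contract_eq_zero _ _ (ofFun_mem f x), add_zero, flatDeriv_ofFun]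

theorem covDeriv_smul (x : M) (f : SmoothFun n M) (Y : MVF n M) :
    c.covDeriv x (f • Y) =
      (mvfderiv (𝓡 n) f x).toLinearMap.smulRight (Y.1 x) + f x • c.covDeriv x Y := by
  ext v
  rw [smul_eq_ofFun_mul, covDeriv_mul, covDeriv_ofFun, ofFun_apply, ← Algebra.smul_def,
    LinearMap.smulRight_apply, smul_one_mul]
  rfl

theorem covDeriv_mem {x : M} {l : ℕ} {Y : MVF n M} (hY : Y ∈ A n M l)
    (v : TangentSpace (𝓡 n) x) : c.covDeriv x Y v ∈ ⋀[ℝ]^l (TangentSpace (𝓡 n) x) := by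
  refine Submodule.add_mem _ (flatDeriv_mem hY v) ?_
  cases l with
  | zero =>
    rw [LinearMap.comp_apply, LinearMap.flip_apply, contract_eq_zero _ _ (hY x)]
    exact Submodule.zero_mem _
  | succ l =>
    have hι (w : TangentSpace (𝓡 n) x) :
        ExteriorAlgebra.ι ℝ (c.christoffel x v w) ∈ ⋀[ℝ]^1 (TangentSpace (𝓡 n) x) :=
      ι_mem_exteriorPower_one _
    exact contract_mem (tangentBasis x) (T := ExteriorAlgebra.ι ℝ ∘ₗ c.christoffel x v) hι (hY x)

theorem covDeriv_congr {x : M} {Y Z : MVF n M} (h : ∀ᶠ y in 𝓝 x, Y.1 y = Z.1 y) :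
    c.covDeriv x Y = c.covDeriv x Z := by
  rw [covDeriv, covDeriv, flatDeriv_congr h, h.self_of_nhds]

theorem covDeriv_extVector (x : M) (v w : TangentSpace (𝓡 n) x) :
    c.covDeriv x (ofVField (extVector x w)) v =
      ExteriorAlgebra.ι ℝ (c.toFun (extVector x v) (extVector x w) x) := by
  rw [covDeriv_apply, ← extend_ι, flatDeriv_extend, extend_self, contract_ι, LinearMap.zero_apply,
    zero_add]
  rfl

theorem toFun_extVector (V W : VField n M) (x : M) :
    c.toFun (extVector x (V x)) W x = c.toFun V W x :=
  apply_extVector_of_tensorial (x := x) (T := fun V => c.toFun V W x)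
    (fun V V' => by rw [c.add_left]; rfl) (fun f V => by rw [c.smul_left]; rfl) V

/- The difference of the two sides is tensorial in `W`. -/
theorem covDeriv_ofVField (V W : VField n M) (x : M) :
    c.covDeriv x (ofVField W) (V x) = ExteriorAlgebra.ι ℝ (c.toFun V W x) := by
  let T (W : VField n M) : ExteriorAlgebra ℝ (TangentSpace (𝓡 n) x) :=
    c.covDeriv x (ofVField W) (V x) - ExteriorAlgebra.ι ℝ (c.toFun V W x)
  have add (W W' : VField n M) : T (W + W') = T W + T W' := by
    have hadd : c.toFun V (W + W') x = c.toFun V W x + c.toFun V W' x := by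
      rw [c.add_right]; rfl
    simp only [T, ofVField_add, covDeriv_add, LinearMap.add_apply, hadd, map_add]
    abel
  have smul (f : SmoothFun n M) (W : VField n M) : T (fsmul f W) = f x • T W := by
    simp only [T, ofVField_fsmul, covDeriv_smul, c.leibniz, map_add, map_smul, LinearMap.add_apply,
      LinearMap.smul_apply, LinearMap.smulRight_apply, smul_sub, ofVField_apply]
    exact add_sub_add_left_eq_sub _ _ _
  have hzero : T W = 0 := by
    rw [← apply_extVector_of_tensorial add smul W]
    simp only [T, covDeriv_extVector, toFun_extVector, sub_self]
  exact sub_eq_zero.1 hzero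

theorem isSmooth_covDeriv (V : VField n M) (Y : MVF n M) :
    IsSmooth fun x => c.covDeriv x Y (V x) := by
  refine isSmooth_of_wedge (T := fun Y x => c.covDeriv x Y (V x)) ?_ ?_ ?_ ?_ Y
  · exact fun h => by rw [c.covDeriv_congr h]
  · exact fun Y Z => funext fun x => by rw [covDeriv_add]; rfl
  · intro f Y hY
    simp only [covDeriv_smul]
    exact isSmooth_add (isSmooth_smul (contMDiff_mvfderiv_apply f V) Y.2)
      (isSmooth_smul f.contMDiff hY)
  · intro L
    induction L with
    | nil =>
      rw [wedge_nil, ← map_one (ofFun n M)]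
      simp only [covDeriv_ofFun]
      exact isSmooth_smul (contMDiff_mvfderiv_apply 1 V) (MVF n M).one_mem
    | cons W L ih =>
      simp only [wedge_cons, covDeriv_mul, covDeriv_ofVField]
      exact isSmooth_add (isSmooth_mul (ofVField (c.toFun V W)).2 (wedge L).2)
        (isSmooth_mul (ofVField W).2 ih)

theorem isSmooth_contract_covDeriv (X Y : MVF n M) :
    IsSmooth fun x => contract (tangentBasis x) (c.covDeriv x Y) (X.1 x) := by
  refine isSmooth_of_wedge (T := fun X x => contract (tangentBasis x) (c.covDeriv x Y) (X.1 x))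
    ?_ ?_ ?_ ?_ X
  · exact fun h => by rw [h.self_of_nhds]
  · exact fun X X' => funext fun x => map_add _ (X.1 x) (X'.1 x)
  · intro f X hX
    simp only [smul_apply, map_smul]
    exact isSmooth_smul f.contMDiff hX
  · intro L
    induction L with
    | nil =>
      rw [wedge_nil, ← map_one (ofFun n M)]
      simp only [contract_eq_zero _ _ (ofFun_mem 1 _)]
      exact (MVF n M).zero_mem
    | cons V L ih =>
      have hcons (x : M) : contract (tangentBasis x) (c.covDeriv x Y) ((wedge (V :: L)).1 x) =
          (ofVField V).1 x * contract (tangentBasis x) (c.covDeriv x Y) ((wedge L).1 x) +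
            ((-1) ^ (1 * L.length) * wedge L).1 x * c.covDeriv x Y (V x) := by
        rw [wedge_cons, neg_one_pow_mul_apply, mul_assoc, ← contract_ι (tangentBasis x) _ (V x)]
        exact contract_mul _ _ (ofVField_mem V x) (wedge_mem L x)
      simp only [hcons]
      exact isSmooth_add (isSmooth_mul (ofVField V).2 ih)
        (isSmooth_mul ((-1) ^ (1 * L.length) * wedge L).2 (c.isSmooth_covDeriv V Y))

/-- The higher connection induced by an affine connection: `∇_X Y` is obtained by substituting the
covariant derivative of `Y` in the last slot of `X`. -/
def induced : HigherConnection n M where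
  toFun X Y := ⟨fun x => contract (tangentBasis x) (c.covDeriv x Y) (X.1 x),
    c.isSmooth_contract_covDeriv X Y⟩
  degree k l m hm X hX Y hY x := by
    cases k with
    | zero =>
      change contract _ _ _ ∈ _
      rw [contract_eq_zero _ _ (hX x)]
      exact Submodule.zero_mem _
    | succ k =>
      obtain rfl : m = k + l := by omega
      exact contract_mem _ (c.covDeriv_mem hY) (hX x)
  linear_left f X X' Y := by
    ext x : 1
    change contract _ _ ((f • X).1 x + X'.1 x) = (f • _ : MVF n M).1 x + _
    rw [map_add, smul_apply, smul_apply, map_smul]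
  add_right X Y Y' := by
    ext x : 1
    change contract _ (c.covDeriv x (Y + Y')) _ = _ + _
    rw [covDeriv_add, map_add]
    rfl
  apply_fun k X _ f := by
    funext x
    change contract _ (c.covDeriv x _) _ = _
    rw [covDeriv_ofFun, contract_smulRight, mul_one]
    rfl
  leibniz k X _ f Y := by
    funext x
    change contract _ (c.covDeriv x _) _ = _ + (f • _ : MVF n M).1 x
    rw [covDeriv_smul, map_add, map_smul, LinearMap.add_apply, contract_smulRight, smul_apply]
    rfl
  fun_left f X := by
    ext x : 1
    exact contract_eq_zero _ _ (ofFun_mem f x)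

theorem isInducedBy_induced : IsInducedBy c.induced c := by
  refine ⟨fun k l X hX Y hY Z => ⟨?_, ?_⟩, fun V W => ?_⟩
  · ext x : 1
    exact contract_mul _ _ (hX x) (hY x)
  · ext x : 1
    exact contract_of_forall_eq_add _ (c.covDeriv_mul x Y Z) (hX x) (hY x)
  · ext x : 1
    exact (contract_ι _ _ (V x)).trans (c.covDeriv_ofVField V W x)

end AffineConnection

end InducedConnection

section HigherConnections

variable {n : ℕ} {M : Type*} [TopologicalSpace M] [ChartedSpace (Model n) M] [IsManifold (𝓡 n) ∞ M]

theorem bracket_one (X : MVF n M) : bracket X 1 = 0 := by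
  funext x
  have h1 : mvfderiv (𝓡 n) (1 : SmoothFun n M) x = 0 := mvfderiv_const _
  rw [bracket, h1]
  exact map_zero (contractRight (X.1 x))

namespace HigherConnection

variable (N D : HigherConnection n M)

theorem zero_left (Y : MVF n M) : N.toFun 0 Y = 0 := by
  simpa only [map_zero] using N.fun_left 0 Y

theorem smul_left (f : SmoothFun n M) (X Y : MVF n M) : N.toFun (f • X) Y = f • N.toFun X Y := by
  have h := N.linear_left f X 0 Y
  rwa [add_zero, zero_left, add_zero] at h

theorem add_left (X X' Y : MVF n M) : N.toFun (X + X') Y = N.toFun X Y + N.toFun X' Y := by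
  have h := N.linear_left 1 X X' Y
  rwa [one_smul, one_smul] at h

theorem one_left (Y : MVF n M) : N.toFun 1 Y = 0 := by
  rw [← map_one (ofFun n M), N.fun_left]

theorem one_right {k : ℕ} {X : MVF n M} (hX : X ∈ A n M k) : N.toFun X 1 = 0 := by
  ext x : 1
  rw [← map_one (ofFun n M), N.apply_fun k X hX, bracket_one]
  rfl

theorem toFun_ofVField_mem (V W : VField n M) :
    N.toFun (ofVField V) (ofVField W) ∈ A n M 1 :=
  N.degree 1 1 1 rfl _ (ofVField_mem V) _ (ofVField_mem W)

theorem toFun_smul_apply {k : ℕ} {X : MVF n M} (hX : X ∈ A n M k) (f : SmoothFun n M)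
    (Y : MVF n M) (x : M) :
    (N.toFun X (f • Y)).1 x = bracket X f x * Y.1 x + f x • (N.toFun X Y).1 x := by
  rw [N.leibniz k X hX, Pi.add_apply, smul_apply]
  rfl

theorem toVField_toFun_fsmul (f : SmoothFun n M) (V W : VField n M) (x : M) :
    toVField (N.toFun (ofVField V) (ofVField (fsmul f W))) x =
      mvfderiv (𝓡 n) f x (V x) • W x +
        f x • toVField (N.toFun (ofVField V) (ofVField W)) x := by
  have h := N.toFun_smul_apply (ofVField_mem V) f (ofVField W) x
  rw [bracket_ofVField, rawOfFun, ← Algebra.smul_def] at h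
  refine ((congrArg ExteriorAlgebra.ιInv ((ofVField_fsmul f W) ▸ h)).trans (map_add _ _ _)).trans ?_
  rw [map_smul, map_smul, ofVField_apply, ExteriorAlgebra.ι_leftInverse]
  rfl

/-- The affine connection obtained by restricting a higher connection to vector fields. -/
def restrict : AffineConnection n M where
  toFun V W := toVField (N.toFun (ofVField V) (ofVField W))
  add_left V V' W := by rw [ofVField_add, add_left, toVField_add]
  smul_left f V W := by rw [ofVField_fsmul, smul_left, toVField_smul]
  add_right V W W' := by rw [ofVField_add, N.add_right, toVField_add]
  const_smul_right r V W := by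
    ext1 x
    have hr : mvfderiv (𝓡 n) (ContMDiffMap.const r : SmoothFun n M) x = 0 := mvfderiv_const _
    rw [← fsmul_const, toVField_toFun_fsmul, hr]
    exact (congrArg (· + _) (zero_smul ℝ (W x))).trans (zero_add _)
  leibniz := N.toVField_toFun_fsmul

theorem ofVField_restrict (V W : VField n M) :
    ofVField (N.restrict.toFun V W) = N.toFun (ofVField V) (ofVField W) :=
  ofVField_toVField (N.toFun_ofVField_mem V W)

/-- The difference of two higher connections at a point, as a function of the first argument. -/
def diffLeft (Y : MVF n M) (x : M) :
    TensorialMap (n := n) x (ExteriorAlgebra ℝ (TangentSpace (𝓡 n) x)) where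
  toFun X := (N.toFun X Y - D.toFun X Y).1 x
  map_add' X X' := by
    rw [add_left, add_left, add_sub_add_comm]
    rfl
  map_smul' f X := by
    rw [smul_left, smul_left, ← smul_sub, smul_apply]
    rfl

/-- The difference of two higher connections at a point, as a function of the second argument. -/
def diffRight {k : ℕ} {X : MVF n M} (hX : X ∈ A n M k) (x : M) :
    TensorialMap (n := n) x (ExteriorAlgebra ℝ (TangentSpace (𝓡 n) x)) where
  toFun Y := (N.toFun X Y - D.toFun X Y).1 x
  map_add' Y Y' := by
    rw [N.add_right, D.add_right, add_sub_add_comm]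
    rfl
  map_smul' f Y := by
    change (N.toFun X (f • Y)).1 x - (D.toFun X (f • Y)).1 x = f x • (_ - _)
    rw [N.toFun_smul_apply hX, D.toFun_smul_apply hX, add_sub_add_left_eq_sub, smul_sub]

variable [T2Space M]

variable {N D} in
theorem toFun_eq_of_wedge_left {Y : MVF n M}
    (h : ∀ L, N.toFun (wedge L) Y = D.toFun (wedge L) Y) (X : MVF n M) :
    N.toFun X Y = D.toFun X Y := by
  ext x : 1
  have hzero : N.diffLeft D Y x = 0 :=
    TensorialMap.ext_wedge fun L => congrFun (congrArg Subtype.val (sub_eq_zero.2 (h L))) x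
  exact sub_eq_zero.1 (DFunLike.congr_fun hzero X)

variable {N D} in
theorem toFun_eq_of_wedge_right {k : ℕ} {X : MVF n M} (hX : X ∈ A n M k)
    (h : ∀ L, N.toFun X (wedge L) = D.toFun X (wedge L)) (Y : MVF n M) :
    N.toFun X Y = D.toFun X Y := by
  ext x : 1
  have hzero : N.diffRight D hX x = 0 :=
    TensorialMap.ext_wedge fun L => congrFun (congrArg Subtype.val (sub_eq_zero.2 (h L))) x
  exact sub_eq_zero.1 (DFunLike.congr_fun hzero Y)

variable {N D} in
theorem IsInduced.eq_of_ofVField (hN : N.IsInduced) (hD : D.IsInduced)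
    (h : ∀ V W : VField n M,
      N.toFun (ofVField V) (ofVField W) = D.toFun (ofVField V) (ofVField W)) : N = D := by
  have hV (V : VField n M) : ∀ Y, N.toFun (ofVField V) Y = D.toFun (ofVField V) Y :=
    toFun_eq_of_wedge_right (ofVField_mem V) fun L => by
      induction L with
      | nil => rw [wedge_nil, N.one_right (ofVField_mem V), D.one_right (ofVField_mem V)]
      | cons W L ih =>
        rw [wedge_cons, (hN 1 1 _ (ofVField_mem V) _ (ofVField_mem W) _).2,
          (hD 1 1 _ (ofVField_mem V) _ (ofVField_mem W) _).2, ih, h]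
  ext1
  funext X Y
  refine toFun_eq_of_wedge_left (fun L => ?_) X
  induction L with
  | nil => rw [wedge_nil, one_left, one_left]
  | cons V L ih =>
    rw [wedge_cons, (hN 1 _ _ (ofVField_mem V) _ (wedge_mem L) _).1,
      (hD 1 _ _ (ofVField_mem V) _ (wedge_mem L) _).1, ih, hV]

variable {N D} in
theorem eq_of_homogeneous (h : ∀ k l : ℕ, 0 < k → 0 < l → k + l - 1 ≤ n → ∀ X ∈ A n M k,
    ∀ Y ∈ A n M l, N.toFun X Y = D.toFun X Y) : N = D := by
  ext1
  funext X Y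
  refine toFun_eq_of_wedge_left (fun L => ?_) X
  refine toFun_eq_of_wedge_right (wedge_mem L) (fun L' => ?_) Y
  rcases L with _ | ⟨V, L⟩
  · rw [wedge_nil, one_left, one_left]
  rcases L' with _ | ⟨W, L'⟩
  · rw [wedge_nil, N.one_right (wedge_mem _), D.one_right (wedge_mem _)]
  have hX := wedge_mem (V :: L)
  have hY := wedge_mem (W :: L')
  rw [List.length_cons] at hX hY
  by_cases hn : L.length + 1 + (L'.length + 1) - 1 ≤ n
  · exact h _ _ (Nat.succ_pos _) (Nat.succ_pos _) hn _ hX _ hY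
  · have hm : L.length + 1 + (L'.length + 1) - 1 + 1 = L.length + 1 + (L'.length + 1) := by omega
    rw [eq_zero_of_mem_A (not_le.1 hn) (N.degree _ _ _ hm _ hX _ hY),
      eq_zero_of_mem_A (not_le.1 hn) (D.degree _ _ _ hm _ hX _ hY)]

theorem diff_extend_extend {k : ℕ} {X : MVF n M} (hX : X ∈ A n M k) (Y : MVF n M) (x : M) :
    (N.toFun (extend x (X.1 x)) (extend x (Y.1 x)) -
      D.toFun (extend x (X.1 x)) (extend x (Y.1 x))).1 x = (N.toFun X Y - D.toFun X Y).1 x :=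
  ((N.diffLeft D _ x).apply_extend X).trans ((N.diffRight D hX x).apply_extend Y)

/-- The difference of two higher connections, as a tensor field. -/
def diffTensor (k l : ℕ) (hk : 0 < k) : TensorField n M k l (k + l - 1) where
  toFun x := LinearMap.mk₂ ℝ
    (fun ξ η => ⟨(N.toFun (extend x ξ.1) (extend x η.1) -
        D.toFun (extend x ξ.1) (extend x η.1)).1 x,
      Submodule.sub_mem (A n M (k + l - 1))
        (N.degree k l _ (by omega) _ (extend_mem ξ.2) _ (extend_mem η.2))
        (D.degree k l _ (by omega) _ (extend_mem ξ.2) _ (extend_mem η.2)) x⟩)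
    (fun ξ ξ' η => Subtype.ext <| by
      have h := map_add (N.diffLeft D (extend x η.1) x) (extend x ξ.1) (extend x ξ'.1)
      rwa [← map_add] at h)
    (fun r ξ η => Subtype.ext ((N.diffLeft D (extend x η.1) x).map_extend_smul r ξ.1))
    (fun ξ η η' => Subtype.ext <| by
      have h := map_add (N.diffRight D (extend_mem ξ.2) x) (extend x η.1) (extend x η'.1)
      rwa [← map_add] at h)
    (fun r ξ η => Subtype.ext ((N.diffRight D (extend_mem ξ.2) x).map_extend_smul r η.1))
  smooth X Y := by
    refine (congrArg IsSmooth (funext fun x => ?_)).mpr (N.toFun X.1 Y.1 - D.toFun X.1 Y.1).2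
    exact N.diff_extend_extend D X.2 Y.1 x

theorem diffTensor_apply {k l : ℕ} (hk : 0 < k) (X : A n M k) (Y : A n M l) (x : M) :
    ((N.diffTensor D k l hk).toFun x ⟨X.1.1 x, X.2 x⟩ ⟨Y.1.1 x, Y.2 x⟩ :
      ExteriorAlgebra ℝ (TangentSpace (𝓡 n) x)) = (N.toFun X Y).1 x - (D.toFun X Y).1 x :=
  N.diff_extend_extend D X.2 Y.1 x

end HigherConnection

theorem TensorField.ext_apply [T2Space M] {k l m : ℕ} {F G : TensorField n M k l m}
    (h : ∀ (X : A n M k) (Y : A n M l) (x : M),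
      (F.toFun x ⟨X.1.1 x, X.2 x⟩ ⟨Y.1.1 x, Y.2 x⟩ : ExteriorAlgebra ℝ (TangentSpace (𝓡 n) x)) =
        G.toFun x ⟨X.1.1 x, X.2 x⟩ ⟨Y.1.1 x, Y.2 x⟩) : F = G := by
  ext1
  funext x
  refine LinearMap.ext fun ξ => LinearMap.ext fun η => Subtype.ext ?_
  simpa only [extend_self] using h ⟨_, extend_mem ξ.2⟩ ⟨_, extend_mem η.2⟩ x

variable {N D : HigherConnection n M}

theorem IsInducedBy.unique [T2Space M] {c : AffineConnection n M} (hN : IsInducedBy N c)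
    (hD : IsInducedBy D c) : N = D :=
  hN.1.eq_of_ofVField hD.1 fun V W => (hN.2 V W).trans (hD.2 V W).symm

theorem HigherConnection.isInduced_iff_eq_induced [T2Space M] :
    N.IsInduced ↔ N = N.restrict.induced := by
  refine ⟨fun hN => ?_, fun hN => hN ▸ N.restrict.isInducedBy_induced.1⟩
  exact IsInducedBy.unique ⟨hN, fun V W => (N.ofVField_restrict V W).symm⟩
    N.restrict.isInducedBy_induced

namespace IsAssociated

variable {d d' : ConnectionData n M}

/- For `n = 0` the data have no component `F^{1,1}`, but then there are no nonzero vector fields. -/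
theorem conn_eq (hd : IsAssociated N d) : d.conn = N.restrict := by
  obtain ⟨D, ⟨-, hD⟩, h⟩ := hd
  ext V W : 3
  refine ofVField_injective ?_
  rw [N.ofVField_restrict, ← hD]
  rcases Nat.eq_zero_or_pos n with rfl | hn
  · rw [eq_zero_of_mem_A one_pos (D.toFun_ofVField_mem V W),
      eq_zero_of_mem_A one_pos (N.toFun_ofVField_mem V W)]
  · ext x : 1
    rw [h 1 1 one_pos one_pos hn ⟨_, ofVField_mem V⟩ ⟨_, ofVField_mem W⟩ x, d.twist_one_one]
    exact (add_zero _).symm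

variable [T2Space M]

theorem twist_eq (hd : IsAssociated N d) (k l : ℕ) (hk : 0 < k) (hl : 0 < l)
    (hkl : k + l - 1 ≤ n) :
    d.twist k l hk hl hkl = N.diffTensor N.restrict.induced k l hk := by
  have hconn := hd.conn_eq
  obtain ⟨D, hD, h⟩ := hd
  rw [hconn] at hD
  obtain rfl : D = N.restrict.induced := hD.unique N.restrict.isInducedBy_induced
  refine TensorField.ext_apply fun X Y x => ?_
  rw [HigherConnection.diffTensor_apply, h k l hk hl hkl, add_sub_cancel_left]

theorem unique (hd : IsAssociated N d) (hd' : IsAssociated N d') : d = d' := by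
  ext1
  · rw [hd.conn_eq, hd'.conn_eq]
  · funext k l hk hl hkl
    rw [hd.twist_eq, hd'.twist_eq]

theorem isInduced_iff (hd : IsAssociated N d) :
    N.IsInduced ↔ ∀ (k l : ℕ) (hk : 0 < k) (hl : 0 < l) (hkl : k + l - 1 ≤ n) (x : M),
      (d.twist k l hk hl hkl).toFun x = 0 := by
  rw [HigherConnection.isInduced_iff_eq_induced]
  refine ⟨fun hN k l hk hl hkl x => ?_, fun h => ?_⟩
  · rw [hd.twist_eq, ← hN]
    refine LinearMap.ext fun ξ => LinearMap.ext fun η => Subtype.ext ?_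
    exact sub_self _
  · refine HigherConnection.eq_of_homogeneous fun k l hk hl hkl X hX Y hY => ?_
    ext x : 1
    have hzero := N.diffTensor_apply N.restrict.induced hk ⟨X, hX⟩ ⟨Y, hY⟩ x
    rw [← hd.twist_eq k l hk hl hkl, h] at hzero
    exact sub_eq_zero.1 hzero.symm

end IsAssociated

variable [T2Space M] (N)

/-- The affine connection and the twist fields of a higher connection. -/
def connectionData : ConnectionData n M where
  conn := N.restrict
  twist k l hk _ _ := N.diffTensor N.restrict.induced k l hk
  twist_one_one _ x := by
    refine LinearMap.ext fun ξ => LinearMap.ext fun η => Subtype.ext ?_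
    change (N.toFun (extend x ξ.1) (extend x η.1) -
      N.restrict.induced.toFun (extend x ξ.1) (extend x η.1)).1 x = 0
    rw [← ofVField_toVField (extend_mem ξ.2), ← ofVField_toVField (extend_mem η.2),
      N.restrict.isInducedBy_induced.2, N.ofVField_restrict, sub_self]
    rfl

theorem isAssociated_connectionData : IsAssociated N (connectionData N) := by
  refine ⟨N.restrict.induced, N.restrict.isInducedBy_induced, fun k l hk hl hkl X Y x => ?_⟩
  exact eq_add_of_sub_eq' (N.diffTensor_apply _ hk X Y x).symm

end HigherConnections

end HigherConn

end

theorem mainTheorem3_general (n : ℕ) (M : Type*) [TopologicalSpace M] [T2Space M]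
    [ChartedSpace (HigherConn.Model n) M] [IsManifold (𝓡 n) ∞ M]
    (N : HigherConn.HigherConnection n M) :
    (∃! d : HigherConn.ConnectionData n M, HigherConn.IsAssociated N d) ∧
    ∀ d : HigherConn.ConnectionData n M, HigherConn.IsAssociated N d →
      (N.IsInduced ↔ ∀ (k l : ℕ) (hk : 0 < k) (hl : 0 < l) (hkl : k + l - 1 ≤ n) (x : M),
        (d.twist k l hk hl hkl).toFun x = 0) :=
  ⟨⟨_, HigherConn.isAssociated_connectionData N,
    fun _ hd => hd.unique (HigherConn.isAssociated_connectionData N)⟩,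
    fun _ hd => hd.isInduced_iff⟩

theorem mainTheorem3 (n : ℕ) (M : Type*) [TopologicalSpace M] [T2Space M]
    [SecondCountableTopology M] [ChartedSpace (HigherConn.Model n) M] [IsManifold (𝓡 n) ∞ M]
    (N : HigherConn.HigherConnection n M) :
    (∃! d : HigherConn.ConnectionData n M, HigherConn.IsAssociated N d) ∧
    ∀ d : HigherConn.ConnectionData n M, HigherConn.IsAssociated N d →
      (N.IsInduced ↔ ∀ (k l : ℕ) (hk : 0 < k) (hl : 0 < l) (hkl : k + l - 1 ≤ n) (x : M),
        (d.twist k l hk hl hkl).toFun x = 0) :=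
  mainTheorem3_general n M N
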